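/- **Setting.** Let $\mathcal M$ be a finite-dimensional smooth manifold (without boundary, Hausdorff, second countable) with a smooth Riemannian metric. Let $\mathcal E$ be a Euclidean space, $\mathcal X\subseteq\mathcal E$, and let $\varphi\colon\mathcal M\to\mathcal E$ be a smooth map with $\varphi(\mathcal M)=\mathcal X$. Let $f$ be a real-valued function on $\mathcal X$ and put $g=f\circ\varphi\colon\mathcal M\to\mathbb R$. Let $\mathrm R\colon \mathrm T\mathcal M\to\mathcal M$ be a retraction, that is, a smooth map such that, for all $y\in\mathcal M$ and $u\in \mathrm T_y\mathcal M$, the curve $c(t)=\mathrm R_y(tu)$ satisfies $c(0)=y$ and $c'(0)=u$. Let $\Phi\colon\mathcal M\to\mathcal M$ be an arbitrary map (the *hook*). For $g$ twice continuously differentiable and $y\in\mathcal M$, let $\nabla g(y)$ be the Riemannian gradient of $g$ and let $\hat g_y=g\circ \mathrm R_y\colon \mathrm T_y\mathcal M\to\mathbb R$, a function on a Euclidean space. Let $\lambda(y)$ be the least eigenvalue of $\nabla^2\hat g_y(0)$ (with $\lambda(y)=0$ if $\mathrm T_y\mathcal M=\{0\}$), let $\lambda(y)_-=\min(\lambda(y),0)$,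 and let $$m_y(s)=g(y)+\langle s,\nabla\hat g_y(0)\rangle+\tfrac12\langle s,\nabla^2\hat g_y(0)[s]\rangle .$$ **Algorithm 1 (trust-region method with hook).** The parameters are $\gamma_c,\eta\in(0,1)$ and $0<\underline\gamma\le\overline\gamma<\infty$. The inputs are $y_{\rm in}\in\mathcal M$ and $\gamma_0\in[\underline\gamma,\overline\gamma]$. Set $y_0=\Phi(y_{\rm in})$. For $k=0,1,2,\dots$: * If $\lambda(y_k)<0$ and $\|\nabla g(y_k)\|^2<|\lambda(y_k)_-|^3$, set $\delta_k=\gamma_k|\lambda(y_k)_-|$ and let $u_k$ be a unit-norm eigenvector of $\nabla^2\hat g_{y_k}(0)$ for the eigenvalue $\lambda(y_k)$ with $\langle u_k,\nabla g(y_k)\rangle\le0$. Otherwise, set $\delta_k=\gamma_k\|\nabla g(y_k)\|$ and $u_k=-\nabla g(y_k)$. * The Cauchy step is $s_k^c=t_ku_k$, where $t_k$ minimizes $m_{y_k}(tu_k)$ over all $t\ge0$ with $\|tu_k\|\le\delta_k$. Choose any $s_k\in \mathrm T_{y_k}\mathcal M$ with $\|s_k\|\le\delta_k$ and $m_{y_k}(s_k)\le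 m_{y_k}(s_k^c)$. * Set $\rho_k=\dfrac{g(y_k)-g(\mathrm R_{y_k}(s_k))}{m_{y_k}(0)-m_{y_k}(s_k)}$, or $\rho_k=1$ if the denominator is zero. * If $\rho_k\ge\eta$, set $y_{k+1}=\Phi(\mathrm R_{y_k}(s_k))$ and choose any $\gamma_{k+1}\in[\underline\gamma,\overline\gamma]$. Otherwise, set $y_{k+1}=y_k$ and $\gamma_{k+1}=\gamma_c\gamma_k$. A point $y\in\mathcal M$ is *2-critical* for $g$ if $(g\circ c)'(0)=0$ and $(g\circ c)''(0)\ge0$ for every smooth curve $c\colon\mathbb R\to\mathcal M$ with $c(0)=y$. **Theorem.** Suppose that $g$ is three times continuously differentiable and that $\varphi\circ\Phi=\varphi$. Let $(y_k)_{k\ge0}$ be any sequence generated by Algorithm 1, and let $x_0=\varphi(y_0)$. Then $y_k\in\mathcal L$ for all $k$, where $$\mathcal L=\Phi\bigl(\{y\in\mathcal M: g(y)\le g(y_0)\}\bigr)=\Phi\bigl(\varphi^{-1}(\{x\in\mathcal X: f(x)\le f(x_0)\})\bigr)$$ (the equality of the two sets is part of the claim). Moreover, if $\mathcal L$ is contained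 in a compact subset of $\mathcal M$, then $(y_k)$ has at least one accumulation point in $\mathcal M$, and every accumulation point of $(y_k)$ is 2-critical for $g$. -/

import Mathlib

open Set Filter Topology Manifold Bundle
open scoped ContDiff InnerProductSpace

noncomputable section

namespace HookedTR

/-- The Hessian of a function on a Euclidean space, as a linear map: the derivative of its
gradient. -/
def hessian {V : Type*} [NormedAddCommGroup V] [InnerProductSpace ℝ V] [CompleteSpace V]
    (h : V → ℝ) (x : V) : V →L[ℝ] V :=
  fderiv ℝ (gradient h) x

/-- The left-most (least) real eigenvalue of a linear map; by convention `0` on the zero space,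
where there is no eigenvalue. -/
def leastEigenvalue {V : Type*} [NormedAddCommGroup V] [InnerProductSpace ℝ V]
    (A : V →L[ℝ] V) : ℝ :=
  sInf {μ : ℝ | Module.End.HasEigenvalue (A : V →ₗ[ℝ] V) μ}

section Manifold

variable {E : Type*} [NormedAddCommGroup E] [NormedSpace ℝ E] [FiniteDimensional ℝ E]
  {M : Type*} [TopologicalSpace M] [ChartedSpace E M]

instance tangentSpace_finiteDimensional (y : M) :
    FiniteDimensional ℝ (TangentSpace 𝓘(ℝ, E) y) :=
  inferInstanceAs (FiniteDimensional ℝ E)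

/-- `y` is second-order stationary (2-critical) for `g`: along every smooth curve through `y`,
the first derivative of `g` vanishes and the second derivative is nonnegative. -/
def IsTwoCritical (E : Type*) [NormedAddCommGroup E] [NormedSpace ℝ E]
    {M : Type*} [TopologicalSpace M] [ChartedSpace E M] (g : M → ℝ) (y : M) : Prop :=
  ∀ c : ℝ → M, ContMDiff 𝓘(ℝ, ℝ) 𝓘(ℝ, E) ∞ c → c 0 = y →
    deriv (g ∘ c) 0 = 0 ∧ 0 ≤ deriv (deriv (g ∘ c)) 0

variable [IsManifold 𝓘(ℝ, E) ∞ M]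

/-- A retraction: a smooth map `R` from the tangent bundle to the manifold such that each curve
`c(t) = R_y(t u)` satisfies `c(0) = y` and `c'(0) = u`. -/
structure IsRetraction (R : TangentBundle 𝓘(ℝ, E) M → M) : Prop where
  smooth : ContMDiff (𝓘(ℝ, E).tangent) 𝓘(ℝ, E) ∞ R
  map_zero : ∀ y : M, R ⟨y, 0⟩ = y
  /-- The tangent map of `c` sends the unit tangent vector of `ℝ` at `0` to `u ∈ T_y M`. -/
  velocity : ∀ (y : M) (u : TangentSpace 𝓘(ℝ, E) y),
    tangentMap 𝓘(ℝ, ℝ) 𝓘(ℝ, E) (fun t : ℝ => R ⟨y, t • u⟩)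
      (⟨(0 : ℝ), (1 : ℝ)⟩ : TangentBundle 𝓘(ℝ, ℝ) ℝ) = ⟨y, u⟩

variable [RiemannianBundle (fun y : M => TangentSpace 𝓘(ℝ, E) y)]

instance tangentSpace_completeSpace (y : M) : CompleteSpace (TangentSpace 𝓘(ℝ, E) y) :=
  FiniteDimensional.complete ℝ _

/-- The Riemannian gradient of `g` at `y`: the tangent vector that represents the differential
of `g` at `y` through the inner product of the tangent space. -/
def rgrad (g : M → ℝ) (y : M) : TangentSpace 𝓘(ℝ, E) y :=
  (InnerProductSpace.toDual ℝ (TangentSpace 𝓘(ℝ, E) y)).symm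
    (mfderiv 𝓘(ℝ, E) 𝓘(ℝ, ℝ) g y : TangentSpace 𝓘(ℝ, E) y →L[ℝ] ℝ)

/-- The pullback `g ∘ R_y` of the cost function to the tangent space at `y`. -/
def pullback (R : TangentBundle 𝓘(ℝ, E) M → M) (g : M → ℝ) (y : M) :
    TangentSpace 𝓘(ℝ, E) y → ℝ :=
  fun s => g (R ⟨y, s⟩)

/-- The second-order Taylor model of the pullback at `0`. -/
def model (R : TangentBundle 𝓘(ℝ, E) M → M) (g : M → ℝ) (y : M)
    (s : TangentSpace 𝓘(ℝ, E) y) : ℝ :=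
  g y + ⟪s, gradient (pullback R g y) 0⟫_ℝ
    + (1 / 2) * ⟪s, hessian (pullback R g y) 0 s⟫_ℝ

/-- The left-most eigenvalue of the Hessian of the pullback at `0`. -/
def lam (R : TangentBundle 𝓘(ℝ, E) M → M) (g : M → ℝ) (y : M) : ℝ :=
  leastEigenvalue (hessian (pullback R g y) 0)

/-- The test of the algorithm that selects an eigenvalue iteration (type `𝒦₂`); the other
iterations are gradient iterations (type `𝒦₁`). -/
def IsEigenStep (R : TangentBundle 𝓘(ℝ, E) M → M) (g : M → ℝ) (y : M) : Prop :=
  lam R g y < 0 ∧ ‖(rgrad g y : TangentSpace 𝓘(ℝ, E) y)‖ ^ 2 < |min (lam R g y) 0| ^ 3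

open Classical in
/-- The trust-region radius `δ` at `y` for the parameter `γ`. -/
def radius (R : TangentBundle 𝓘(ℝ, E) M → M) (g : M → ℝ) (y : M) (γ : ℝ) : ℝ :=
  if IsEigenStep R g y then γ * |min (lam R g y) 0| else γ * ‖(rgrad g y : TangentSpace 𝓘(ℝ, E) y)‖

/-- `u` is an admissible Cauchy direction at `y`: a unit-norm eigenvector of the Hessian of the
pullback for its left-most eigenvalue, making a nonpositive inner product with the gradient, at an
eigenvalue iteration; the negative gradient at a gradient iteration. -/
def IsCauchyDirection (R : TangentBundle 𝓘(ℝ, E) M → M) (g : M → ℝ) (y : M)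
    (u : TangentSpace 𝓘(ℝ, E) y) : Prop :=
  (IsEigenStep R g y → ‖u‖ = 1 ∧ hessian (pullback R g y) 0 u = lam R g y • u ∧
      ⟪u, rgrad g y⟫_ℝ ≤ 0) ∧
  (¬ IsEigenStep R g y → u = -rgrad g y)

/-- `sc` is a Cauchy step at `y` for the radius `δ`: `sc = t u` with `u` a Cauchy direction and
`t` a minimizer of the model along the ray of `u`, within the trust region. -/
def IsCauchyStep (R : TangentBundle 𝓘(ℝ, E) M → M) (g : M → ℝ) (y : M) (δ : ℝ)
    (sc : TangentSpace 𝓘(ℝ, E) y) : Prop :=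
  ∃ u : TangentSpace 𝓘(ℝ, E) y, IsCauchyDirection R g y u ∧
    ∃ t : ℝ, sc = t • u ∧
      t ∈ {t : ℝ | 0 ≤ t ∧ ‖t • u‖ ≤ δ} ∧
      IsMinOn (fun t : ℝ => model R g y (t • u)) {t : ℝ | 0 ≤ t ∧ ‖t • u‖ ≤ δ} t

open Classical in
/-- The ratio `ρ` of actual to predicted decrease (`1` if the denominator is zero). -/
def ratio (R : TangentBundle 𝓘(ℝ, E) M → M) (g : M → ℝ) (y : M)
    (s : TangentSpace 𝓘(ℝ, E) y) : ℝ :=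
  if model R g y 0 - model R g y s = 0 then 1
  else (g y - g (R ⟨y, s⟩)) / (model R g y 0 - model R g y s)

/-- `(y_k, s_k, γ_k)` is a sequence generated by the hooked Riemannian trust-region method for
the cost `g`, with retraction `R`, hook `Φ`, parameters `γc`, `η`, `γlo`, `γhi` and input point
`yin`. All choices that the method leaves open are arbitrary. -/
structure IsRun (R : TangentBundle 𝓘(ℝ, E) M → M) (g : M → ℝ) (Φ : M → M)
    (γc η γlo γhi : ℝ) (yin : M)
    (y : ℕ → M) (s : ∀ k, TangentSpace 𝓘(ℝ, E) (y k)) (γ : ℕ → ℝ) : Prop where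
  init : y 0 = Φ yin
  init_gamma : γ 0 ∈ Icc γlo γhi
  norm_step : ∀ k, ‖s k‖ ≤ radius R g (y k) (γ k)
  model_step : ∀ k, ∃ sc : TangentSpace 𝓘(ℝ, E) (y k),
    IsCauchyStep R g (y k) (radius R g (y k) (γ k)) sc ∧
      model R g (y k) (s k) ≤ model R g (y k) sc
  success : ∀ k, η ≤ ratio R g (y k) (s k) →
    y (k + 1) = Φ (R ⟨y k, s k⟩) ∧ γ (k + 1) ∈ Icc γlo γhi
  failure : ∀ k, ratio R g (y k) (s k) < η →
    y (k + 1) = y k ∧ γ (k + 1) = γc * γ k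

end Manifold

end HookedTR

end

/-! Let ψ(y) be the larger of ‖∇g(y)‖² and |λ(y)_-|³ (`criticality`). The radius is γ times ‖∇g‖ or
|λ_-|, whichever quantity realizes ψ, so a step at least as good as the Cauchy step lowers the model
by order γψ or γ²ψ when γ is small (`model_decrease`). Over a compact set, third derivatives along
retraction curves are bounded, so the model error is O(‖s‖³) = O(γ³ψ). Hence iterations with small γ
succeed (`le_ratio_of_gamma_le`), γ stays bounded away from zero, and each success lowers g by at
least cψ(y_k). The hook is harmless because φ ∘ Φ = φ gives g ∘ Φ = g; Φ need not be continuous. A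
failure leaves y_k, hence ψ(y_k), unchanged. As g is bounded below along the run, ψ(y_k) → 0
(`IsRun.tendsto_criticality`).

At an accumulation point z, continuity of λ is not needed: a vector u at z is extended to a field U
continuous at z, and the inequalities for U(y_k) pass to the limit (`criticality_at_cluster_point`).
So dg(z) = 0 and g has nonnegative second derivative along retraction curves. Where dg vanishes, the
second derivative along a curve depends only on its velocity, so arbitrary smooth curves follow
(`isTwoCritical_of_lineCost`). -/

namespace HookedTR

/-! ### Gradients and Hessians as derivatives along lines. -/

section Euclidean

variable {V : Type*} [NormedAddCommGroup V] [InnerProductSpace ℝ V]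

theorem deriv_comp_smul {h : V → ℝ} (hh : ContDiff ℝ 1 h) (s : V) :
    deriv (fun t : ℝ => h (t • s)) = fun t => fderiv ℝ h (t • s) s := by
  funext t
  have h1 : HasDerivAt (fun t : ℝ => t • s) s t := by
    simpa using (hasDerivAt_id t).smul_const s
  exact ((hh.differentiable one_ne_zero _).hasFDerivAt.comp_hasDerivAt t h1).deriv

theorem deriv_deriv_comp_smul {h : V → ℝ} (hh : ContDiff ℝ 2 h) (s : V) (t : ℝ) :
    deriv (deriv (fun t : ℝ => h (t • s))) t = fderiv ℝ (fderiv ℝ h) (t • s) s s := by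
  rw [deriv_comp_smul (hh.of_le (by norm_num)) s]
  have h1 : HasDerivAt (fun t : ℝ => t • s) s t := by
    simpa using (hasDerivAt_id t).smul_const s
  have h2 : ContDiff ℝ 1 (fderiv ℝ h) := hh.fderiv_right (by norm_num)
  have h3 := (h2.differentiable one_ne_zero (t • s)).hasFDerivAt.comp_hasDerivAt t h1
  exact ((ContinuousLinearMap.apply ℝ ℝ s).hasFDerivAt.comp_hasDerivAt t h3).deriv

variable [CompleteSpace V]

theorem inner_gradient {h : V → ℝ} (x s : V) :
    ⟪s, gradient h x⟫_ℝ = fderiv ℝ h x s := by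
  rw [real_inner_comm, gradient, InnerProductSpace.toDual_symm_apply]

theorem inner_gradient_zero {h : V → ℝ} (hh : ContDiff ℝ 1 h) (s : V) :
    ⟪s, gradient h 0⟫_ℝ = deriv (fun t : ℝ => h (t • s)) 0 := by
  rw [deriv_comp_smul hh, inner_gradient]; simp

theorem inner_hessian {h : V → ℝ} (hh : ContDiff ℝ 2 h) (x v w : V) :
    ⟪w, hessian h x v⟫_ℝ = fderiv ℝ (fderiv ℝ h) x v w := by
  have h2 : ContDiff ℝ 1 (fderiv ℝ h) := hh.fderiv_right (by norm_num)
  have h3 := (h2.differentiable one_ne_zero x).hasFDerivAt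
  have h4 := ((InnerProductSpace.toDual ℝ V).symm.toContinuousLinearEquiv :
    (V →L[ℝ] ℝ) ≃L[ℝ] V).hasFDerivAt.comp x h3
  have h5 : fderiv ℝ (gradient h) x = _ := h4.fderiv
  rw [hessian, h5, real_inner_comm]
  exact InnerProductSpace.toDual_symm_apply

theorem inner_hessian_zero_self {h : V → ℝ} (hh : ContDiff ℝ 2 h) (s : V) :
    ⟪s, hessian h 0 s⟫_ℝ = deriv (deriv (fun t : ℝ => h (t • s))) 0 := by
  rw [deriv_deriv_comp_smul hh, inner_hessian hh]; simp

theorem isSymmetric_hessian {h : V → ℝ} (hh : ContDiff ℝ 2 h) (x : V) :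
    (hessian h x : V →ₗ[ℝ] V).IsSymmetric := by
  intro v w
  have hs : IsSymmSndFDerivAt ℝ h x := hh.contDiffAt.isSymmSndFDerivAt (by simp)
  change ⟪hessian h x v, w⟫_ℝ = ⟪v, hessian h x w⟫_ℝ
  rw [real_inner_comm, inner_hessian hh, inner_hessian hh, hs.eq]

end Euclidean

/-! ### Rayleigh quotients. -/

section LeastEigenvalue

variable {V : Type*} [NormedAddCommGroup V] [InnerProductSpace ℝ V]

/-- For a symmetric map, the infimum of the Rayleigh quotient is itself an eigenvalue, hence is at
least the infimum of all eigenvalues. -/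
theorem leastEigenvalue_mul_norm_sq_le [FiniteDimensional ℝ V] {A : V →L[ℝ] V}
    (hA : (A : V →ₗ[ℝ] V).IsSymmetric) (s : V) :
    leastEigenvalue A * ‖s‖ ^ 2 ≤ ⟪s, A s⟫_ℝ := by
  by_cases hs : s = 0
  · simp [hs]
  have : Nontrivial V := ⟨s, 0, hs⟩
  have hev := hA.hasEigenvalue_iInf_of_finiteDimensional
  have hlow : ∀ x : V, x ≠ 0 → -‖A‖ ≤ ⟪A x, x⟫_ℝ / ‖x‖ ^ 2 := by
    intro x hx
    have hx' : 0 < ‖x‖ ^ 2 := by positivity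
    rw [le_div_iff₀ hx']
    have h1 := abs_real_inner_le_norm (A x) x
    have h2 := A.le_opNorm x
    have h3 : ‖A x‖ * ‖x‖ ≤ ‖A‖ * ‖x‖ * ‖x‖ := by gcongr
    have := neg_abs_le ⟪A x, x⟫_ℝ
    nlinarith
  have hb : BddBelow {μ : ℝ | Module.End.HasEigenvalue (A : V →ₗ[ℝ] V) μ} := by
    refine ⟨-‖A‖, fun μ hμ => ?_⟩
    obtain ⟨x, hx⟩ := hμ.exists_hasEigenvector
    have h1 : A x = μ • x := hx.apply_eq_smul
    have h2 := hlow x hx.2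
    have hx' : ‖x‖ ≠ 0 := norm_ne_zero_iff.2 hx.2
    rw [h1, real_inner_smul_left, real_inner_self_eq_norm_sq] at h2
    field_simp at h2
    exact h2
  have h1 := csInf_le hb hev
  have h2 : (⨅ x : {x : V // x ≠ 0}, ⟪A x, (x : V)⟫_ℝ / ‖(x : V)‖ ^ 2) ≤ ⟪A s, s⟫_ℝ / ‖s‖ ^ 2 :=
    ciInf_le (f := fun x : {x : V // x ≠ 0} => ⟪A x, (x : V)⟫_ℝ / ‖(x : V)‖ ^ 2)
      ⟨-‖A‖, by rintro _ ⟨x, rfl⟩; exact hlow x x.2⟩ ⟨s, hs⟩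
  have h3 : leastEigenvalue A ≤ ⟪A s, s⟫_ℝ / ‖s‖ ^ 2 := h1.trans h2
  have hs' : 0 < ‖s‖ ^ 2 := by positivity
  rwa [le_div_iff₀ hs', real_inner_comm] at h3

end LeastEigenvalue

/-! ### Taylor expansion in one variable. -/

section Line

/-- Second-order Taylor expansion of a thrice differentiable function of one variable with bounded
third derivative. -/
theorem abs_sub_taylor_two_le {p p' p'' p''' : ℝ → ℝ} (h1 : ∀ t, HasDerivAt p (p' t) t)
    (h2 : ∀ t, HasDerivAt p' (p'' t) t) (h3 : ∀ t, HasDerivAt p'' (p''' t) t) {B r : ℝ}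
    (hB : ∀ t ∈ Icc 0 r, |p''' t| ≤ B) {τ : ℝ} (hτ : τ ∈ Icc 0 r) :
    |p τ - p 0 - τ * p' 0 - 1 / 2 * (τ ^ 2 * p'' 0)| ≤ B * τ ^ 3 := by
  obtain ⟨h0, hr⟩ := hτ
  have hB0 : 0 ≤ B := (abs_nonneg _).trans (hB 0 ⟨le_rfl, h0.trans hr⟩)
  -- Integrating the bound on p''' three times by the mean value inequality gives Bτ³ instead of
  -- Bτ³/6; the constant is immaterial.
  have mv : ∀ (q q' : ℝ → ℝ) (C : ℝ), (∀ t, HasDerivAt q (q' t) t) → q 0 = 0 →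
      (∀ t ∈ Icc 0 τ, |q' t| ≤ C) → ∀ t ∈ Icc 0 τ, |q t| ≤ C * τ := by
    intro q q' C hq hq0 hC t ht
    have hC0 : 0 ≤ C := (abs_nonneg _).trans (hC t ht)
    have := norm_image_sub_le_of_norm_deriv_le_segment' (f := q) (f' := q') (a := 0) (b := τ)
      (C := C) (fun x _ => (hq x).hasDerivWithinAt) (fun x hx => hC x ⟨hx.1, hx.2.le⟩) t ht
    rw [hq0, sub_zero, sub_zero] at this
    exact this.trans (by gcongr; exact ht.2)
  have a1 := mv (fun t => p'' t - p'' 0) p''' B (fun t => (h3 t).sub_const _) (sub_self _)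
    (fun t ht => hB t ⟨ht.1, ht.2.trans hr⟩)
  have a2 := mv (fun t => p' t - p' 0 - t * p'' 0) (fun t => p'' t - p'' 0) (B * τ)
    (fun t => by
      have := ((h2 t).sub_const (p' 0)).sub ((hasDerivAt_id t).mul_const (p'' 0))
      rw [one_mul] at this
      exact this)
    (by simp) a1
  have a3 := mv (fun t => p t - p 0 - t * p' 0 - 1 / 2 * (t ^ 2 * p'' 0))
    (fun t => p' t - p' 0 - t * p'' 0) (B * τ * τ)
    (fun t => by
      have := (((h1 t).sub_const (p 0)).sub ((hasDerivAt_id t).mul_const (p' 0))).sub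
        ((((hasDerivAt_id t).pow 2).mul_const (p'' 0)).const_mul (1 / 2))
      refine this.congr_deriv ?_
      simp only [id, Nat.cast_ofNat]
      ring)
    (by simp) a2
  exact (a3 τ ⟨h0, le_rfl⟩).trans (by nlinarith)

end Line

end HookedTR

namespace HookedTR

/-! ### Real sequences behind the convergence argument. -/

section Sequence

/-- Along a sequence of radius parameters that are reset above `lo` at successful iterations,
multiplied by `γc` at failures, and never fail below `γs`, the parameters stay bounded away from
zero. -/
theorem min_le_gamma {S : ℕ → Prop} {γ : ℕ → ℝ} {γc lo γs : ℝ} (hγc : 0 < γc)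
    (h0 : lo ≤ γ 0) (hS : ∀ k, S k → lo ≤ γ (k + 1))
    (hF : ∀ k, ¬ S k → γ (k + 1) = γc * γ k) (hbig : ∀ k, ¬ S k → γs < γ k) (k : ℕ) :
    min lo (γc * γs) ≤ γ k := by
  induction k with
  | zero => exact (min_le_left _ _).trans h0
  | succ k ih =>
    by_cases h : S k
    · exact (min_le_left _ _).trans (hS k h)
    · rw [hF k h]
      have := hbig k h
      exact (min_le_right _ _).trans (by gcongr)

/-- If failures shrink the parameters geometrically while these stay bounded away from zero, then
every iteration is followed by a successful one. -/
theorem exists_success {S : ℕ → Prop} {γ : ℕ → ℝ} {γc c : ℝ} (hγc : 0 < γc) (hγc1 : γc < 1)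
    (hc : 0 < c) (hlow : ∀ k, c ≤ γ k) (hF : ∀ k, ¬ S k → γ (k + 1) = γc * γ k) (k : ℕ) :
    ∃ j ≥ k, S j ∧ ∀ i, k ≤ i → i < j → ¬ S i := by
  have hex : ∃ n, S (k + n) := by
    by_contra! hno
    have h1 : ∀ n, γ (k + n) = γc ^ n * γ k := by
      intro n
      induction n with
      | zero => simp
      | succ n ih => rw [← add_assoc, hF _ (hno n), ih]; ring
    have h2 : Tendsto (fun n : ℕ => γc ^ n * γ k) atTop (𝓝 (0 * γ k)) :=
      (tendsto_pow_atTop_nhds_zero_of_lt_one hγc.le hγc1).mul_const _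
    have h3 : c ≤ 0 * γ k := ge_of_tendsto' h2 fun n => by rw [← h1]; exact hlow _
    linarith
  classical
  refine ⟨k + Nat.find hex, Nat.le_add_right _ _, Nat.find_spec hex, fun i hi hij hS => ?_⟩
  refine Nat.find_min hex (m := i - k) (by omega) ?_
  rwa [Nat.add_sub_cancel' hi]

/-- If a sequence bounded below decreases by at least a multiple of `ψ` at successful iterations,
while `ψ` is unchanged by failures and every iteration is followed by a success, then `ψ → 0`. -/
theorem tendsto_criticality_zero {S : ℕ → Prop} {G ψ : ℕ → ℝ} {c b : ℝ} (hc : 0 < c)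
    (hb : ∀ k, b ≤ G k) (hψ : ∀ k, 0 ≤ ψ k) (hG : ∀ k, G (k + 1) ≤ G k)
    (hS : ∀ k, S k → G (k + 1) ≤ G k - c * ψ k) (hF : ∀ k, ¬ S k → ψ (k + 1) = ψ k)
    (hex : ∀ k, ∃ j ≥ k, S j ∧ ∀ i, k ≤ i → i < j → ¬ S i) : Tendsto ψ atTop (𝓝 0) := by
  have hanti : Antitone G := antitone_nat_of_succ_le hG
  have hlim := tendsto_atTop_ciInf hanti ⟨b, by rintro _ ⟨k, rfl⟩; exact hb k⟩
  set ℓ := ⨅ i, G i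
  have hℓ : ∀ k, ℓ ≤ G k := fun k => hanti.le_of_tendsto hlim k
  -- ψ is constant from k up to the next success j, and the decrease at j cannot exceed what remains
  -- above the limit ℓ.
  have hbound : ∀ k, ψ k ≤ c⁻¹ * (G k - ℓ) := by
    intro k
    obtain ⟨j, hkj, hSj, hno⟩ := hex k
    have hconst : ∀ i, k ≤ i → i ≤ j → ψ i = ψ k := by
      intro i hi
      induction i, hi using Nat.le_induction with
      | base => intro _; rfl
      | succ i hi ih => intro hij; rw [hF i (hno i hi (by omega)), ih (by omega)]
    rw [← hconst j hkj le_rfl, ← div_eq_inv_mul, le_div_iff₀ hc]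
    have h1 := hS j hSj
    have h2 := hℓ (j + 1)
    have h3 := hanti hkj
    linarith
  refine squeeze_zero hψ hbound ?_
  have := (hlim.sub_const ℓ).const_mul c⁻¹
  simpa using this

end Sequence

/-! ### Decrease of quadratic models. -/

section Decrease

variable {V : Type*} [NormedAddCommGroup V] [InnerProductSpace ℝ V]

/-- Decrease of the quadratic model along the negative gradient. -/
theorem exists_decrease_gradient (A : V →L[ℝ] V) (d : V) {C γ : ℝ} (hC : 0 < C) (hγ : 0 ≤ γ)
    (hA : ⟪d, A d⟫_ℝ ≤ C * ‖d‖ ^ 2) :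
    ∃ t : ℝ, 0 ≤ t ∧ ‖t • (-d)‖ ≤ γ * ‖d‖ ∧
      ⟪t • (-d), d⟫_ℝ + 1 / 2 * ⟪t • (-d), A (t • (-d))⟫_ℝ
        ≤ -(1 / 2 * min γ C⁻¹ * ‖d‖ ^ 2) := by
  -- t ≤ γ keeps the step in the trust region; t ≤ C⁻¹ makes the curvature term at most half of the
  -- linear decrease.
  set t := min γ C⁻¹
  have ht : 0 ≤ t := le_min hγ (inv_nonneg.2 hC.le)
  refine ⟨t, ht, ?_, ?_⟩
  · rw [norm_smul, norm_neg, Real.norm_of_nonneg ht]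
    gcongr
    exact min_le_left _ _
  · have htC : t * C ≤ 1 := by
      calc t * C ≤ C⁻¹ * C := by gcongr; exact min_le_right _ _
        _ = 1 := inv_mul_cancel₀ hC.ne'
    simp only [smul_neg, map_neg, map_smul, inner_neg_left, inner_neg_right, neg_neg,
      real_inner_smul_left, real_inner_smul_right, real_inner_self_eq_norm_sq]
    have h1 : t * (t * ⟪d, A d⟫_ℝ) ≤ t * (t * (C * ‖d‖ ^ 2)) := by gcongr
    have h2 : t * C * (t * ‖d‖ ^ 2) ≤ 1 * (t * ‖d‖ ^ 2) := by gcongr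
    nlinarith

/-- Decrease of the quadratic model along an eigenvector for a negative eigenvalue. -/
theorem decrease_eigenvector (A : V →L[ℝ] V) {d u : V} {l γ : ℝ} (hl : l < 0) (hγ : 0 ≤ γ)
    (hu : ‖u‖ = 1) (hAu : A u = l • u) (hd : ⟪u, d⟫_ℝ ≤ 0) :
    ⟪(γ * |l|) • u, d⟫_ℝ + 1 / 2 * ⟪(γ * |l|) • u, A ((γ * |l|) • u)⟫_ℝ
      ≤ -(1 / 2 * γ ^ 2 * |l| ^ 3) := by
  simp only [map_smul, hAu, real_inner_smul_left, real_inner_smul_right,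
    real_inner_self_eq_norm_sq, hu, abs_of_neg hl]
  have : γ * -l * ⟪u, d⟫_ℝ ≤ 0 :=
    mul_nonpos_of_nonneg_of_nonpos (mul_nonneg hγ (by linarith)) hd
  nlinarith

end Decrease

end HookedTR

namespace HookedTR

/-! ### Smooth dependence of derivatives on parameters. -/

section ParametricDerivative

variable {H N E' : Type*} [NormedAddCommGroup E'] [NormedSpace ℝ E'] [TopologicalSpace H]
  {I : ModelWithCorners ℝ E' H} [TopologicalSpace N] [ChartedSpace H N]
  [IsManifold I 1 N]

/-- The evaluation point is made part of the parameter q = (x, t), so that smoothness of a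
parametrized differential gives joint smoothness in x and t. -/
theorem contMDiff_deriv_param {F : N → ℝ → ℝ} {m n : ℕ∞ω}
    (hF : ContMDiff (I.prod 𝓘(ℝ, ℝ)) 𝓘(ℝ, ℝ) n (Function.uncurry F)) (hmn : m + 1 ≤ n) :
    ContMDiff (I.prod 𝓘(ℝ, ℝ)) 𝓘(ℝ, ℝ) m (Function.uncurry fun x => deriv (F x)) := by
  intro p
  have hf : ContMDiff ((I.prod 𝓘(ℝ, ℝ)).prod 𝓘(ℝ, ℝ)) 𝓘(ℝ, ℝ) n
      (Function.uncurry fun (q : N × ℝ) (t : ℝ) => F q.1 t) :=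
    hF.comp ((contMDiff_fst.comp contMDiff_fst).prodMk contMDiff_snd)
  have := ContMDiffAt.mfderiv_apply (J := I.prod 𝓘(ℝ, ℝ)) (m := m) (x₀ := p)
    (fun (q : N × ℝ) (t : ℝ) => F q.1 t) (fun q => q.2) id (fun _ => (1 : ℝ))
    (hf _) contMDiffAt_snd contMDiffAt_id contMDiffAt_const hmn
  refine this.congr_of_eventuallyEq (Eventually.of_forall fun q => ?_)
  simp [inTangentCoordinates_model_space, Function.uncurry, mfderiv_eq_fderiv]

end ParametricDerivative

/-! ### Smoothness and compactness in the tangent bundle. -/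

section Bundle

variable {E : Type*} [NormedAddCommGroup E] [NormedSpace ℝ E]
  {M : Type*} [TopologicalSpace M] [ChartedSpace E M] [IsManifold 𝓘(ℝ, E) ∞ M]

theorem contMDiff_smul_tangent :
    ContMDiff (𝓘(ℝ, E).tangent.prod 𝓘(ℝ, ℝ)) 𝓘(ℝ, E).tangent ∞
      (fun p : TangentBundle 𝓘(ℝ, E) M × ℝ =>
        (⟨p.1.1, p.2 • p.1.2⟩ : TangentBundle 𝓘(ℝ, E) M)) := by
  intro p
  have hfst : ContMDiffAt (𝓘(ℝ, E).tangent.prod 𝓘(ℝ, ℝ)) 𝓘(ℝ, E).tangent ∞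
      (Prod.fst : TangentBundle 𝓘(ℝ, E) M × ℝ → _) p := contMDiffAt_fst
  have h := contMDiffAt_totalSpace.1 hfst
  refine contMDiffAt_totalSpace.2 ⟨h.1, ?_⟩
  have h2 := (contMDiffAt_snd (I := 𝓘(ℝ, E).tangent) (J := 𝓘(ℝ, ℝ)) (p := p)
    (n := ∞)).smul h.2
  refine h2.congr_of_eventuallyEq ?_
  have hb : ∀ᶠ q in 𝓝 p, q.1.1 ∈ (trivializationAt E (TangentSpace 𝓘(ℝ, E)) p.1.1).baseSet :=
    h.1.continuousAt.eventually_mem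
      ((trivializationAt E (TangentSpace 𝓘(ℝ, E)) p.1.1).open_baseSet.mem_nhds
        (FiberBundle.mem_baseSet_trivializationAt' _))
  filter_upwards [hb] with q hq
  exact ((trivializationAt E (TangentSpace 𝓘(ℝ, E)) p.1.1).linear ℝ hq).map_smul q.2 q.1.2

/-- Every tangent vector extends to a vector field that is continuous at its base point. -/
theorem exists_section_continuousAt (z : M) (u : TangentSpace 𝓘(ℝ, E) z) :
    ∃ U : ∀ y : M, TangentSpace 𝓘(ℝ, E) y, U z = u ∧
      ContinuousAt (fun y => (⟨y, U y⟩ : TangentBundle 𝓘(ℝ, E) M)) z := by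
  set e := trivializationAt E (fun y : M => TangentSpace 𝓘(ℝ, E) y) z
  have hz : z ∈ e.baseSet := FiberBundle.mem_baseSet_trivializationAt' z
  -- The field is constant in the trivialization at z.
  refine ⟨fun y => e.symm y (e ⟨z, u⟩).2, e.symm_apply_apply_mk hz u, ?_⟩
  have h1 : ContinuousAt (fun y : M => e.toOpenPartialHomeomorph.symm (y, (e ⟨z, u⟩).2)) z := by
    refine ContinuousAt.comp (f := fun y : M => (y, (e ⟨z, u⟩).2))
      (e.toOpenPartialHomeomorph.continuousAt_symm (e.mem_target.2 hz)) (by fun_prop)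
  refine h1.congr ?_
  filter_upwards [e.open_baseSet.mem_nhds hz] with y hy
  exact (e.mk_symm hy _).symm

variable [RiemannianBundle (fun y : M => TangentSpace 𝓘(ℝ, E) y)]

theorem contMDiff_mk_tangent (y : M) :
    ContMDiff 𝓘(ℝ, TangentSpace 𝓘(ℝ, E) y) 𝓘(ℝ, E).tangent ∞
      (fun s : TangentSpace 𝓘(ℝ, E) y => (⟨y, s⟩ : TangentBundle 𝓘(ℝ, E) M)) := by
  intro s
  refine contMDiffAt_totalSpace.2 ⟨contMDiffAt_const, ?_⟩
  have := ((trivializationAt E (TangentSpace 𝓘(ℝ, E)) y).continuousLinearMapAt ℝ y).contDiff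
    (n := ∞)
  refine this.contMDiff.contMDiffAt.congr_of_eventuallyEq (Eventually.of_forall fun v => ?_)
  simp only
  rw [Trivialization.continuousLinearMapAt_apply, Trivialization.linearMapAt_apply,
    if_pos (FiberBundle.mem_baseSet_trivializationAt' y)]

variable [FiniteDimensional ℝ E] [IsContinuousRiemannianBundle E (fun y : M => TangentSpace 𝓘(ℝ, E) y)]

/-- The vectors of norm at most one over a compact set of base points lie in a compact set. -/
theorem exists_isCompact_unitDisc {K : Set M} (hK : IsCompact K) :
    ∃ D : Set (TangentBundle 𝓘(ℝ, E) M), IsCompact D ∧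
      ∀ y ∈ K, ∀ s : TangentSpace 𝓘(ℝ, E) y, ‖s‖ ≤ 1 → (⟨y, s⟩ : TangentBundle 𝓘(ℝ, E) M) ∈ D := by
  have : LocallyCompactSpace M := Manifold.locallyCompact_of_finiteDimensional 𝓘(ℝ, E)
  refine hK.induction_on ⟨∅, isCompact_empty, by simp⟩ ?_ ?_ ?_
  · rintro s t hst ⟨D, hD, h⟩
    exact ⟨D, hD, fun y hy => h y (hst hy)⟩
  · rintro s t ⟨D, hD, h⟩ ⟨D', hD', h'⟩
    exact ⟨D ∪ D', hD.union hD', fun y hy s hs => hy.elim (fun hy => .inl (h y hy s hs))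
      fun hy => .inr (h' y hy s hs)⟩
  · intro z hz
    set e := trivializationAt E (fun y : M => TangentSpace 𝓘(ℝ, E) y) z
    obtain ⟨C, hC, hbound⟩ :=
      eventually_norm_trivializationAt_lt E (fun y : M => TangentSpace 𝓘(ℝ, E) y) z
    have hbase : e.baseSet ∈ 𝓝 z :=
      e.open_baseSet.mem_nhds (FiberBundle.mem_baseSet_trivializationAt' z)
    -- Over U the trivialization has norm below C, so unit discs land in the closed C-ball, compact
    -- since `E` is finite-dimensional.
    obtain ⟨U, hU, hUsub, hUc⟩ := local_compact_nhds (inter_mem hbase hbound)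
    refine ⟨U, mem_nhdsWithin_of_mem_nhds hU,
      e.toOpenPartialHomeomorph.symm '' (U ×ˢ Metric.closedBall 0 C), ?_, ?_⟩
    · refine (hUc.prod (isCompact_closedBall 0 C)).image_of_continuousOn
        (e.toOpenPartialHomeomorph.continuousOn_symm.mono ?_)
      rintro ⟨y, v⟩ hy
      exact e.mem_target.2 (hUsub hy.1).1
    · intro y hy s hs
      have hyb := (hUsub hy).1
      have hsrc : (⟨y, s⟩ : TangentBundle 𝓘(ℝ, E) M) ∈ e.source := e.mem_source.2 hyb
      refine ⟨e ⟨y, s⟩, ⟨?_, ?_⟩, e.toOpenPartialHomeomorph.left_inv hsrc⟩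
      · rwa [e.coe_fst' hyb]
      · have h1 : (e ⟨y, s⟩).2 = e.continuousLinearMapAt ℝ y s := by
          rw [Trivialization.continuousLinearMapAt_apply, Trivialization.linearMapAt_apply,
            if_pos hyb]
        rw [mem_closedBall_zero_iff, h1]
        refine ((e.continuousLinearMapAt ℝ y).le_opNorm s).trans ?_
        have h2 : ‖e.continuousLinearMapAt ℝ y‖ < C := (hUsub hy).2
        nlinarith [norm_nonneg s, norm_nonneg (e.continuousLinearMapAt ℝ y)]

end Bundle

end HookedTR

namespace HookedTR

/-! ### Second derivatives along curves at critical points. -/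

section Curves

variable {E : Type*} [NormedAddCommGroup E] [NormedSpace ℝ E]

/-- At a critical point, the second derivative along a curve is the Hessian quadratic form evaluated
at the velocity. -/
theorem deriv_deriv_comp_of_fderiv_eq_zero {h : E → ℝ} {c : ℝ → E} (hh : ContDiffAt ℝ 2 h (c 0))
    (hc : ContDiffAt ℝ 2 c 0) (h0 : fderiv ℝ h (c 0) = 0) :
    deriv (deriv (h ∘ c)) 0 = fderiv ℝ (fderiv ℝ h) (c 0) (deriv c 0) (deriv c 0) := by
  have hcd : ∀ᶠ t in 𝓝 (0 : ℝ), ContDiffAt ℝ 2 c t := hc.eventually (by simp)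
  have hhd : ∀ᶠ t in 𝓝 (0 : ℝ), ContDiffAt ℝ 2 h (c t) :=
    hc.continuousAt.eventually (hh.eventually (by simp))
  have h1 : deriv (h ∘ c) =ᶠ[𝓝 0] fun t => fderiv ℝ h (c t) (deriv c t) := by
    filter_upwards [hcd, hhd] with t ht ht'
    exact ((ht'.differentiableAt two_ne_zero).hasFDerivAt.comp_hasDerivAt t
      (ht.differentiableAt two_ne_zero).hasDerivAt).deriv
  have h2 : HasFDerivAt (fderiv ℝ h) (fderiv ℝ (fderiv ℝ h) (c 0)) (c 0) :=
    ((hh.fderiv_right (m := 1) (by norm_num)).differentiableAt one_ne_zero).hasFDerivAt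
  have h3 : HasDerivAt c (deriv c 0) 0 := (hc.differentiableAt two_ne_zero).hasDerivAt
  have h4 : DifferentiableAt ℝ (deriv c) 0 :=
    ((hc.fderiv_right (m := 1) (by norm_num)).clm_apply
      (contDiffAt_const (c := (1 : ℝ)))).differentiableAt one_ne_zero
  -- The product rule adds a term Dh(c'') containing the acceleration; `h0` kills it.
  have h5 := (h2.comp_hasDerivAt (0 : ℝ) h3).clm_apply h4.hasDerivAt
  refine h1.deriv_eq.trans (h5.deriv.trans ?_)
  simp [h0]

variable {M : Type*} [TopologicalSpace M] [ChartedSpace E M]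

/-- The derivative of a function along a curve. -/
theorem deriv_comp_curve {g : M → ℝ} (hg : MDifferentiable 𝓘(ℝ, E) 𝓘(ℝ, ℝ) g)
    {c : ℝ → M} (hc : MDifferentiable 𝓘(ℝ, ℝ) 𝓘(ℝ, E) c) (t : ℝ) :
    deriv (g ∘ c) t = mfderiv 𝓘(ℝ, E) 𝓘(ℝ, ℝ) g (c t) (mfderiv 𝓘(ℝ, ℝ) 𝓘(ℝ, E) c t (1 : ℝ)) := by
  have h := mfderiv_comp t (hg (c t)) (hc t)
  rw [mfderiv_eq_fderiv] at h
  rw [← fderiv_apply_one_eq_deriv, h]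
  rfl

/-- At a critical point of `g`, two curves with the same position and velocity at `0` give the same
second derivative. -/
theorem deriv_deriv_comp_curve_eq {g : M → ℝ} (hg : ContMDiff 𝓘(ℝ, E) 𝓘(ℝ, ℝ) 2 g) {z : M}
    (hz : mfderiv 𝓘(ℝ, E) 𝓘(ℝ, ℝ) g z = 0) {c c' : ℝ → M}
    (hc : ContMDiff 𝓘(ℝ, ℝ) 𝓘(ℝ, E) 2 c) (hc' : ContMDiff 𝓘(ℝ, ℝ) 𝓘(ℝ, E) 2 c')
    (h0 : c 0 = z) (h0' : c' 0 = z)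
    (hv : (mfderiv 𝓘(ℝ, ℝ) 𝓘(ℝ, E) c 0 (1 : ℝ) : E) = mfderiv 𝓘(ℝ, ℝ) 𝓘(ℝ, E) c' 0 (1 : ℝ)) :
    deriv (deriv (g ∘ c)) 0 = deriv (deriv (g ∘ c')) 0 := by
  set x := extChartAt 𝓘(ℝ, E) z
  have hgx : ContDiffAt ℝ 2 (g ∘ x.symm) (x z) := by
    have := (contMDiffAt_iff.1 (hg z)).2
    simp only [mfld_simps, contDiffWithinAt_univ] at this
    exact this
  have hdg : fderiv ℝ (g ∘ x.symm) (x z) = 0 := by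
    have := (hg z).mdifferentiableAt two_ne_zero |>.mfderiv
    rw [hz] at this
    simp only [writtenInExtChartAt, fderivWithin_univ, mfld_simps] at this
    exact this.symm
  have key : ∀ c : ℝ → M, ContMDiff 𝓘(ℝ, ℝ) 𝓘(ℝ, E) 2 c → c 0 = z →
      deriv (deriv (g ∘ c)) 0 = fderiv ℝ (fderiv ℝ (g ∘ x.symm)) (x z)
        (mfderiv 𝓘(ℝ, ℝ) 𝓘(ℝ, E) c 0 (1 : ℝ) : E) (mfderiv 𝓘(ℝ, ℝ) 𝓘(ℝ, E) c 0 (1 : ℝ) : E) := by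
    rintro c hc rfl
    have hcx : ContDiffAt ℝ 2 (x ∘ c) 0 := by
      have := (contMDiffAt_iff.1 (hc 0)).2
      simp only [mfld_simps, contDiffWithinAt_univ] at this
      exact this
    have hd : (mfderiv 𝓘(ℝ, ℝ) 𝓘(ℝ, E) c 0 (1 : ℝ) : E) = deriv (x ∘ c) 0 := by
      rw [((hc 0).mdifferentiableAt two_ne_zero).mfderiv]
      simp only [writtenInExtChartAt, fderivWithin_univ, x, mfld_simps]
      rfl
    have heq : g ∘ c =ᶠ[𝓝 0] (g ∘ x.symm) ∘ (x ∘ c) := by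
      filter_upwards [(hc 0).continuousAt.eventually (extChartAt_source_mem_nhds (I := 𝓘(ℝ, E)) (c 0))]
        with t ht
      simp [x.left_inv ht]
    rw [heq.deriv.deriv_eq, hd]
    exact deriv_deriv_comp_of_fderiv_eq_zero (c := x ∘ c) hgx hcx hdg
  rw [key c hc h0, key c' hc' h0', hv]

end Curves

section ModelBasic

variable {E : Type*} [NormedAddCommGroup E] [NormedSpace ℝ E] [FiniteDimensional ℝ E]
  {M : Type*} [TopologicalSpace M] [ChartedSpace E M]
  [RiemannianBundle (fun y : M => TangentSpace 𝓘(ℝ, E) y)]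
  {R : TangentBundle 𝓘(ℝ, E) M → M} {g : M → ℝ}

theorem model_zero (y : M) : model R g y 0 = g y := by
  simp [model]

theorem inner_rgrad (y : M) (u : TangentSpace 𝓘(ℝ, E) y) :
    ⟪u, rgrad g y⟫_ℝ = mfderiv 𝓘(ℝ, E) 𝓘(ℝ, ℝ) g y u := by
  rw [real_inner_comm, rgrad]
  exact InnerProductSpace.toDual_symm_apply

end ModelBasic

/-! ### The cost along retraction curves. -/

section Pullback

variable {E : Type*} [NormedAddCommGroup E] [NormedSpace ℝ E]
  {M : Type*} [TopologicalSpace M] [ChartedSpace E M] [IsManifold 𝓘(ℝ, E) ∞ M]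
  {R : TangentBundle 𝓘(ℝ, E) M → M} {g : M → ℝ}

/-- The cost along the retraction curve of a tangent vector. -/
noncomputable def lineCost (R : TangentBundle 𝓘(ℝ, E) M → M) (g : M → ℝ) (ξ : TangentBundle 𝓘(ℝ, E) M)
    (t : ℝ) : ℝ :=
  g (R ⟨ξ.1, t • ξ.2⟩)

/-- Joint regularity on TM × ℝ is the source of all uniform bounds and limits below: the gradient
and the Hessian form are t-derivatives at 0. -/
theorem contMDiff_lineCost (hR : IsRetraction R) (hg : ContMDiff 𝓘(ℝ, E) 𝓘(ℝ, ℝ) 3 g) :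
    ContMDiff (𝓘(ℝ, E).tangent.prod 𝓘(ℝ, ℝ)) 𝓘(ℝ, ℝ) 3 (Function.uncurry (lineCost R g)) :=
  hg.comp ((hR.smooth.comp contMDiff_smul_tangent).of_le ENat.LEInfty.out)

theorem contMDiff_deriv_lineCost (hR : IsRetraction R) (hg : ContMDiff 𝓘(ℝ, E) 𝓘(ℝ, ℝ) 3 g) :
    ContMDiff (𝓘(ℝ, E).tangent.prod 𝓘(ℝ, ℝ)) 𝓘(ℝ, ℝ) 2
      (Function.uncurry fun ξ => deriv (lineCost R g ξ)) :=
  contMDiff_deriv_param (contMDiff_lineCost hR hg) (by norm_num)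

theorem contMDiff_deriv_deriv_lineCost (hR : IsRetraction R)
    (hg : ContMDiff 𝓘(ℝ, E) 𝓘(ℝ, ℝ) 3 g) :
    ContMDiff (𝓘(ℝ, E).tangent.prod 𝓘(ℝ, ℝ)) 𝓘(ℝ, ℝ) 1
      (Function.uncurry fun ξ => deriv (deriv (lineCost R g ξ))) :=
  contMDiff_deriv_param (contMDiff_deriv_lineCost hR hg) (by norm_num)

theorem continuous_deriv_deriv_deriv_lineCost (hR : IsRetraction R)
    (hg : ContMDiff 𝓘(ℝ, E) 𝓘(ℝ, ℝ) 3 g) :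
    Continuous (Function.uncurry fun ξ => deriv (deriv (deriv (lineCost R g ξ)))) :=
  (contMDiff_deriv_param (m := 0) (contMDiff_deriv_deriv_lineCost hR hg) (by norm_num)).continuous

theorem contDiff_lineCost (hR : IsRetraction R) (hg : ContMDiff 𝓘(ℝ, E) 𝓘(ℝ, ℝ) 3 g)
    (ξ : TangentBundle 𝓘(ℝ, E) M) : ContDiff ℝ 3 (lineCost R g ξ) :=
  ((contMDiff_lineCost hR hg).comp
    ((contMDiff_const (c := ξ)).prodMk contMDiff_id)).contDiff

theorem contMDiff_retraction_curve (hR : IsRetraction R) (y : M) (u : TangentSpace 𝓘(ℝ, E) y) :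
    ContMDiff 𝓘(ℝ, ℝ) 𝓘(ℝ, E) ∞ (fun t : ℝ => R ⟨y, t • u⟩) :=
  (hR.smooth.comp contMDiff_smul_tangent).comp
    ((contMDiff_const (c := (⟨y, u⟩ : TangentBundle 𝓘(ℝ, E) M))).prodMk contMDiff_id)

theorem mfderiv_retraction_curve (hR : IsRetraction R) (y : M) (u : TangentSpace 𝓘(ℝ, E) y) :
    (mfderiv 𝓘(ℝ, ℝ) 𝓘(ℝ, E) (fun t : ℝ => R ⟨y, t • u⟩) 0 (1 : ℝ) : E) = u := by
  have h := congrArg (fun p : TangentBundle 𝓘(ℝ, E) M => (p.2 : E)) (hR.velocity y u)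
  exact h

theorem deriv_lineCost_zero (hR : IsRetraction R) (hg : ContMDiff 𝓘(ℝ, E) 𝓘(ℝ, ℝ) 3 g) (y : M)
    (u : TangentSpace 𝓘(ℝ, E) y) :
    deriv (lineCost R g ⟨y, u⟩) 0 = mfderiv 𝓘(ℝ, E) 𝓘(ℝ, ℝ) g y u := by
  have h := deriv_comp_curve (hg.mdifferentiable three_ne_zero)
    ((contMDiff_retraction_curve hR y u).mdifferentiable (by simp)) 0
  have h0 : R ⟨y, (0 : ℝ) • u⟩ = y := by rw [zero_smul, hR.map_zero]
  have h1 := mfderiv_retraction_curve hR y u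
  refine h.trans ?_
  -- The base points agree only propositionally; regarding vectors as elements of `E` allows
  -- substitution.
  have : ∀ (a b : M) (v w : E), a = b → v = w →
      (mfderiv 𝓘(ℝ, E) 𝓘(ℝ, ℝ) g a : E →L[ℝ] ℝ) v = (mfderiv 𝓘(ℝ, E) 𝓘(ℝ, ℝ) g b : E →L[ℝ] ℝ) w := by
    rintro a _ v _ rfl rfl; rfl
  exact this _ _ _ _ h0 h1

variable [RiemannianBundle (fun y : M => TangentSpace 𝓘(ℝ, E) y)]

theorem contDiff_pullback (hR : IsRetraction R) (hg : ContMDiff 𝓘(ℝ, E) 𝓘(ℝ, ℝ) 3 g) (y : M) :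
    ContDiff ℝ 3 (pullback R g y) :=
  (hg.comp ((hR.smooth.comp (contMDiff_mk_tangent y)).of_le ENat.LEInfty.out)).contDiff

variable [FiniteDimensional ℝ E]

theorem inner_rgrad_eq_deriv (hR : IsRetraction R) (hg : ContMDiff 𝓘(ℝ, E) 𝓘(ℝ, ℝ) 3 g) (y : M)
    (u : TangentSpace 𝓘(ℝ, E) y) : ⟪u, rgrad g y⟫_ℝ = deriv (lineCost R g ⟨y, u⟩) 0 := by
  rw [inner_rgrad, deriv_lineCost_zero hR hg]

/-- The differential of R_y at 0 is the identity, by the velocity condition. -/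
theorem gradient_pullback (hR : IsRetraction R) (hg : ContMDiff 𝓘(ℝ, E) 𝓘(ℝ, ℝ) 3 g) (y : M) :
    gradient (pullback R g y) 0 = rgrad g y := by
  refine ext_inner_left ℝ fun u => ?_
  rw [inner_gradient_zero ((contDiff_pullback hR hg y).of_le (by norm_num)),
    inner_rgrad_eq_deriv hR hg]
  rfl

theorem inner_hessian_pullback (hR : IsRetraction R) (hg : ContMDiff 𝓘(ℝ, E) 𝓘(ℝ, ℝ) 3 g) (y : M)
    (u : TangentSpace 𝓘(ℝ, E) y) :
    ⟪u, hessian (pullback R g y) 0 u⟫_ℝ = deriv (deriv (lineCost R g ⟨y, u⟩)) 0 :=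
  inner_hessian_zero_self ((contDiff_pullback hR hg y).of_le (by norm_num)) u

theorem model_eq (hR : IsRetraction R) (hg : ContMDiff 𝓘(ℝ, E) 𝓘(ℝ, ℝ) 3 g) (y : M)
    (u : TangentSpace 𝓘(ℝ, E) y) :
    model R g y u = g y + (⟪u, rgrad g y⟫_ℝ + 1 / 2 * ⟪u, hessian (pullback R g y) 0 u⟫_ℝ) := by
  rw [model, gradient_pullback hR hg, add_assoc]

theorem lam_mul_norm_sq_le (hR : IsRetraction R) (hg : ContMDiff 𝓘(ℝ, E) 𝓘(ℝ, ℝ) 3 g) (y : M)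
    (u : TangentSpace 𝓘(ℝ, E) y) :
    lam R g y * ‖u‖ ^ 2 ≤ ⟪u, hessian (pullback R g y) 0 u⟫_ℝ :=
  leastEigenvalue_mul_norm_sq_le
    (isSymmetric_hessian ((contDiff_pullback hR hg y).of_le (by norm_num)) 0) u

end Pullback

end HookedTR

namespace HookedTR

/-! ### Uniform bounds over compact sets. -/

section Bounds

variable {E : Type*} [NormedAddCommGroup E] [NormedSpace ℝ E] [FiniteDimensional ℝ E]
  {M : Type*} [TopologicalSpace M] [ChartedSpace E M] [IsManifold 𝓘(ℝ, E) ∞ M]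
  [RiemannianBundle (fun y : M => TangentSpace 𝓘(ℝ, E) y)]
  [IsContinuousRiemannianBundle E (fun y : M => TangentSpace 𝓘(ℝ, E) y)]
  {R : TangentBundle 𝓘(ℝ, E) M → M} {g : M → ℝ}

theorem exists_norm_smul_eq {V : Type*} [NormedAddCommGroup V] [NormedSpace ℝ V] (u : V) :
    ∃ v : V, ‖v‖ ≤ 1 ∧ u = ‖u‖ • v := by
  by_cases hu : u = 0
  · exact ⟨0, by simp, by simp [hu]⟩
  · have h : ‖u‖ ≠ 0 := norm_ne_zero_iff.2 hu
    exact ⟨‖u‖⁻¹ • u, by rw [norm_smul, norm_inv, norm_norm, inv_mul_cancel₀ h],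
      by rw [smul_smul, mul_inv_cancel₀ h, one_smul]⟩

/-- On a compact set, the gradient of the cost and the Hessian of the pullback are bounded. -/
theorem exists_derivative_bound (hR : IsRetraction R) (hg : ContMDiff 𝓘(ℝ, E) 𝓘(ℝ, ℝ) 3 g)
    {K : Set M} (hK : IsCompact K) :
    ∃ C : ℝ, 0 < C ∧ ∀ y ∈ K, ‖(rgrad g y : TangentSpace 𝓘(ℝ, E) y)‖ ≤ C ∧
      ∀ u : TangentSpace 𝓘(ℝ, E) y, |⟪u, hessian (pullback R g y) 0 u⟫_ℝ| ≤ C * ‖u‖ ^ 2 := by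
  obtain ⟨D, hD, hKD⟩ := exists_isCompact_unitDisc (E := E) hK
  obtain ⟨C₁, h₁⟩ := (hD.prod (isCompact_singleton (x := (0 : ℝ)))).exists_bound_of_continuousOn
    (contMDiff_deriv_lineCost hR hg).continuous.continuousOn
  obtain ⟨C₂, h₂⟩ := (hD.prod (isCompact_singleton (x := (0 : ℝ)))).exists_bound_of_continuousOn
    (contMDiff_deriv_deriv_lineCost hR hg).continuous.continuousOn
  refine ⟨max 1 (max C₁ C₂), by positivity, fun y hy => ⟨?_, fun u => ?_⟩⟩
  · obtain ⟨v, hv, hu⟩ := exists_norm_smul_eq (rgrad g y : TangentSpace 𝓘(ℝ, E) y)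
    have h := h₁ (⟨y, v⟩, 0) ⟨hKD y hy v hv, rfl⟩
    rw [Function.uncurry_apply_pair, ← inner_rgrad_eq_deriv hR hg, Real.norm_eq_abs] at h
    refine le_trans ?_ (((le_abs_self _).trans h).trans ((le_max_left _ _).trans (le_max_right _ _)))
    by_cases h0 : ‖(rgrad g y : TangentSpace 𝓘(ℝ, E) y)‖ = 0
    · rw [norm_eq_zero.1 h0]; simp
    · have h3 : ‖(rgrad g y : TangentSpace 𝓘(ℝ, E) y)‖ * ⟪v, rgrad g y⟫_ℝ
          = ‖(rgrad g y : TangentSpace 𝓘(ℝ, E) y)‖ * ‖(rgrad g y : TangentSpace 𝓘(ℝ, E) y)‖ := by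
        rw [← real_inner_smul_left, ← hu, real_inner_self_eq_norm_sq, sq]
      exact (mul_left_cancel₀ h0 h3).ge
  · obtain ⟨v, hv, hu⟩ := exists_norm_smul_eq u
    have h := h₂ (⟨y, v⟩, 0) ⟨hKD y hy v hv, rfl⟩
    rw [Function.uncurry_apply_pair, ← inner_hessian_pullback hR hg, Real.norm_eq_abs] at h
    have h3 : ⟪u, hessian (pullback R g y) 0 u⟫_ℝ
        = ‖u‖ ^ 2 * ⟪v, hessian (pullback R g y) 0 v⟫_ℝ := by
      conv_lhs => rw [hu]
      rw [map_smul, real_inner_smul_left, real_inner_smul_right]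
      ring
    rw [h3, abs_mul, abs_of_nonneg (sq_nonneg _), mul_comm]
    gcongr
    exact h.trans ((le_max_right _ _).trans (le_max_right _ _))

/-- On a compact set and for bounded steps, the model agrees with the pullback to third order. -/
theorem exists_model_error_bound (hR : IsRetraction R) (hg : ContMDiff 𝓘(ℝ, E) 𝓘(ℝ, ℝ) 3 g)
    {K : Set M} (hK : IsCompact K) (r : ℝ) :
    ∃ B : ℝ, 0 ≤ B ∧ ∀ y ∈ K, ∀ u : TangentSpace 𝓘(ℝ, E) y, ‖u‖ ≤ r →
      |g (R ⟨y, u⟩) - model R g y u| ≤ B * ‖u‖ ^ 3 := by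
  obtain ⟨D, hD, hKD⟩ := exists_isCompact_unitDisc (E := E) hK
  obtain ⟨B, hB⟩ := (hD.prod (isCompact_Icc (a := (0 : ℝ)) (b := r))).exists_bound_of_continuousOn
    (continuous_deriv_deriv_deriv_lineCost hR hg).continuousOn
  refine ⟨max B 0, le_max_right _ _, fun y hy u hur => ?_⟩
  obtain ⟨v, hv, hu⟩ := exists_norm_smul_eq u
  -- The expansion runs along t ↦ R(tv) with ‖v‖ ≤ 1, up to t = ‖u‖, so (v, t) ranges over a compact
  -- set.
  have hp := contDiff_lineCost hR hg ⟨y, v⟩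
  have hp1 : ContDiff ℝ 2 (deriv (lineCost R g ⟨y, v⟩)) :=
    (contDiff_succ_iff_deriv (n := 2).1 (hp.of_le (by norm_num))).2.2
  have hp2 : ContDiff ℝ 1 (deriv (deriv (lineCost R g ⟨y, v⟩))) :=
    (contDiff_succ_iff_deriv (n := 1).1 (hp1.of_le (by norm_num))).2.2
  have hT := abs_sub_taylor_two_le
    (fun t => (hp.differentiable three_ne_zero t).hasDerivAt)
    (fun t => (hp1.differentiable two_ne_zero t).hasDerivAt)
    (fun t => (hp2.differentiable one_ne_zero t).hasDerivAt)
    (fun t ht => hB (⟨y, v⟩, t) ⟨hKD y hy v hv, ht⟩) (τ := ‖u‖) ⟨norm_nonneg u, hur⟩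
  have e0 : lineCost R g ⟨y, v⟩ ‖u‖ = g (R ⟨y, u⟩) := by
    change g (R ⟨y, ‖u‖ • v⟩) = _
    rw [← hu]
  have e1 : lineCost R g ⟨y, v⟩ 0 = g y := by
    change g (R ⟨y, (0 : ℝ) • v⟩) = _
    rw [zero_smul, hR.map_zero]
  have e2 : ‖u‖ * deriv (lineCost R g ⟨y, v⟩) 0 = ⟪u, rgrad g y⟫_ℝ := by
    rw [← inner_rgrad_eq_deriv hR hg, ← real_inner_smul_left, ← hu]
  have e3 : ‖u‖ ^ 2 * deriv (deriv (lineCost R g ⟨y, v⟩)) 0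
      = ⟪u, hessian (pullback R g y) 0 u⟫_ℝ := by
    rw [← inner_hessian_pullback hR hg]
    conv_rhs => rw [hu]
    rw [map_smul, real_inner_smul_left, real_inner_smul_right]
    ring
  rw [e0, e1, e2, e3] at hT
  rw [model_eq hR hg]
  calc |g (R ⟨y, u⟩) - (g y + (⟪u, rgrad g y⟫_ℝ + 1 / 2 * ⟪u, hessian (pullback R g y) 0 u⟫_ℝ))|
      = |g (R ⟨y, u⟩) - g y - ⟪u, rgrad g y⟫_ℝ
          - 1 / 2 * ⟪u, hessian (pullback R g y) 0 u⟫_ℝ| := by congr 1; ring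
    _ ≤ B * ‖u‖ ^ 3 := hT
    _ ≤ max B 0 * ‖u‖ ^ 3 := by gcongr; exact le_max_left _ _

end Bounds

/-! ### One iteration: model decrease and acceptance. -/

section Step

variable {E : Type*} [NormedAddCommGroup E] [NormedSpace ℝ E] [FiniteDimensional ℝ E]
  {M : Type*} [TopologicalSpace M] [ChartedSpace E M]
  [RiemannianBundle (fun y : M => TangentSpace 𝓘(ℝ, E) y)]
  {R : TangentBundle 𝓘(ℝ, E) M → M} {g : M → ℝ}

open Classical in
/-- The measure of second-order criticality that controls the model decrease. -/
noncomputable def criticality (R : TangentBundle 𝓘(ℝ, E) M → M) (g : M → ℝ) (y : M) : ℝ :=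
  if IsEigenStep R g y then |min (lam R g y) 0| ^ 3
  else ‖(rgrad g y : TangentSpace 𝓘(ℝ, E) y)‖ ^ 2

theorem criticality_nonneg (y : M) : 0 ≤ criticality R g y := by
  unfold criticality
  split_ifs <;> positivity

theorem norm_rgrad_sq_le_criticality (y : M) :
    ‖(rgrad g y : TangentSpace 𝓘(ℝ, E) y)‖ ^ 2 ≤ criticality R g y := by
  unfold criticality
  split_ifs with h
  · exact h.2.le
  · exact le_rfl

/-- When λ < 0, failure of the eigenvalue test is exactly the required inequality; otherwise the
left side is 0. -/
theorem abs_min_lam_pow_le_criticality (y : M) :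
    |min (lam R g y) 0| ^ 3 ≤ criticality R g y := by
  unfold criticality
  split_ifs with h
  · exact le_rfl
  · by_cases hl : lam R g y < 0
    · exact not_lt.1 fun h' => h ⟨hl, h'⟩
    · rw [min_eq_right (not_lt.1 hl)]
      simp

variable {y : M} {s : TangentSpace 𝓘(ℝ, E) y} {γ C : ℝ}

/-- Where the criticality measure vanishes, the step is zero. -/
theorem step_eq_zero (hns : ‖s‖ ≤ radius R g y γ) (h0 : criticality R g y = 0) : s = 0 := by
  have h1 := norm_rgrad_sq_le_criticality (R := R) (g := g) y
  have h2 := abs_min_lam_pow_le_criticality (R := R) (g := g) y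
  rw [h0] at h1 h2
  have h3 : ‖(rgrad g y : TangentSpace 𝓘(ℝ, E) y)‖ = 0 :=
    pow_eq_zero_iff two_ne_zero |>.1 (le_antisymm h1 (by positivity))
  have h4 : |min (lam R g y) 0| = 0 :=
    pow_eq_zero_iff three_ne_zero |>.1 (le_antisymm h2 (by positivity))
  rw [radius, h3, h4] at hns
  simpa using hns

/-- The trust-region radius is controlled by the derivative bounds. -/
theorem radius_le (hγ : 0 ≤ γ)
    (hgrad : ‖(rgrad g y : TangentSpace 𝓘(ℝ, E) y)‖ ≤ C)
    (hbound : ∀ u : TangentSpace 𝓘(ℝ, E) y,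
      |⟪u, hessian (pullback R g y) 0 u⟫_ℝ| ≤ C * ‖u‖ ^ 2)
    (hs : ∃ sc, IsCauchyStep R g y (radius R g y γ) sc ∧ model R g y s ≤ model R g y sc) :
    radius R g y γ ≤ γ * C := by
  by_cases hE : IsEigenStep R g y
  · obtain ⟨sc, ⟨u, hu, -⟩, -⟩ := hs
    obtain ⟨hu1, hAu, -⟩ := hu.1 hE
    have h := hbound u
    rw [hAu, real_inner_smul_right, real_inner_self_eq_norm_sq, hu1] at h
    rw [radius, if_pos hE, min_eq_left hE.1.le]
    gcongr
    simpa using h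
  · rw [radius, if_neg hE]
    gcongr

variable [IsManifold 𝓘(ℝ, E) ∞ M]

/-- Model decrease for a step that does at least as well as the Cauchy step: eigenvalue
iterations. -/
theorem model_decrease_of_isEigenStep (hR : IsRetraction R)
    (hg : ContMDiff 𝓘(ℝ, E) 𝓘(ℝ, ℝ) 3 g) (hγ : 0 ≤ γ) (hE : IsEigenStep R g y)
    (hs : ∃ sc, IsCauchyStep R g y (radius R g y γ) sc ∧ model R g y s ≤ model R g y sc) :
    1 / 2 * γ ^ 2 * criticality R g y ≤ model R g y 0 - model R g y s := by
  obtain ⟨sc, ⟨u, hu, t, rfl, ht, hmin⟩, hle⟩ := hs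
  obtain ⟨hu1, hAu, hd⟩ := hu.1 hE
  have hm : |min (lam R g y) 0| = |lam R g y| := by rw [min_eq_left hE.1.le]
  have hmem : γ * |lam R g y| ∈ {t : ℝ | 0 ≤ t ∧ ‖t • u‖ ≤ radius R g y γ} := by
    refine ⟨by positivity, ?_⟩
    rw [norm_smul, hu1, mul_one, Real.norm_of_nonneg (by positivity), radius, if_pos hE, hm]
  have h1 : model R g y (t • u) ≤ model R g y ((γ * |lam R g y|) • u) := hmin hmem
  have h2 := decrease_eigenvector (hessian (pullback R g y) 0) hE.1 hγ hu1 hAu hd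
  rw [model_eq hR hg y ((γ * |lam R g y|) • u)] at h1
  rw [criticality, if_pos hE, hm, model_zero]
  linarith

/-- Model decrease for a step that does at least as well as the Cauchy step: gradient
iterations. -/
theorem model_decrease_of_not_isEigenStep (hR : IsRetraction R)
    (hg : ContMDiff 𝓘(ℝ, E) 𝓘(ℝ, ℝ) 3 g) (hγ : 0 ≤ γ) (hC : 0 < C)
    (hbound : ∀ u : TangentSpace 𝓘(ℝ, E) y,
      |⟪u, hessian (pullback R g y) 0 u⟫_ℝ| ≤ C * ‖u‖ ^ 2)
    (hE : ¬ IsEigenStep R g y)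
    (hs : ∃ sc, IsCauchyStep R g y (radius R g y γ) sc ∧ model R g y s ≤ model R g y sc) :
    1 / 2 * min γ C⁻¹ * criticality R g y ≤ model R g y 0 - model R g y s := by
  obtain ⟨sc, ⟨u, hu, t, rfl, ht, hmin⟩, hle⟩ := hs
  obtain rfl := hu.2 hE
  obtain ⟨t', ht', hnorm, hdec⟩ := exists_decrease_gradient (hessian (pullback R g y) 0)
    (rgrad g y) hC hγ ((le_abs_self _).trans (hbound _))
  have hmem : t' ∈ {t : ℝ | 0 ≤ t ∧ ‖t • (-rgrad g y : TangentSpace 𝓘(ℝ, E) y)‖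
      ≤ radius R g y γ} := by
    refine ⟨ht', ?_⟩
    rwa [radius, if_neg hE]
  have h1 : model R g y (t • -rgrad g y) ≤ model R g y (t' • -rgrad g y) := hmin hmem
  rw [model_eq hR hg y (t' • -rgrad g y)] at h1
  rw [criticality, if_neg hE, model_zero]
  linarith

/-- Model decrease in terms of the criticality measure. -/
theorem model_decrease (hR : IsRetraction R) (hg : ContMDiff 𝓘(ℝ, E) 𝓘(ℝ, ℝ) 3 g) (hγ : 0 ≤ γ)
    (hC : 0 < C)
    (hbound : ∀ u : TangentSpace 𝓘(ℝ, E) y,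
      |⟪u, hessian (pullback R g y) 0 u⟫_ℝ| ≤ C * ‖u‖ ^ 2)
    (hs : ∃ sc, IsCauchyStep R g y (radius R g y γ) sc ∧ model R g y s ≤ model R g y sc) :
    1 / 2 * min (γ ^ 2) (min γ C⁻¹) * criticality R g y ≤ model R g y 0 - model R g y s := by
  have h0 := criticality_nonneg (R := R) (g := g) y
  by_cases hE : IsEigenStep R g y
  · refine le_trans ?_ (model_decrease_of_isEigenStep hR hg hγ hE hs)
    exact mul_le_mul_of_nonneg_right
      (mul_le_mul_of_nonneg_left (min_le_left _ _) one_half_pos.le) h0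
  · refine le_trans ?_ (model_decrease_of_not_isEigenStep hR hg hγ hC hbound hE hs)
    exact mul_le_mul_of_nonneg_right
      (mul_le_mul_of_nonneg_left (min_le_right _ _) one_half_pos.le) h0

/-- Cost decrease at a successful iteration. -/
theorem cost_decrease (hR : IsRetraction R) (hg : ContMDiff 𝓘(ℝ, E) 𝓘(ℝ, ℝ) 3 g) (hγ : 0 < γ)
    (hC : 0 < C)
    (hbound : ∀ u : TangentSpace 𝓘(ℝ, E) y,
      |⟪u, hessian (pullback R g y) 0 u⟫_ℝ| ≤ C * ‖u‖ ^ 2)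
    (hns : ‖s‖ ≤ radius R g y γ)
    (hs : ∃ sc, IsCauchyStep R g y (radius R g y γ) sc ∧ model R g y s ≤ model R g y sc)
    {η : ℝ} (hη : 0 < η) (hratio : η ≤ ratio R g y s) :
    g (R ⟨y, s⟩) ≤ g y - η * (1 / 2 * min (γ ^ 2) (min γ C⁻¹)) * criticality R g y := by
  have hdec := model_decrease hR hg hγ.le hC hbound hs
  have hpos : 0 < 1 / 2 * min (γ ^ 2) (min γ C⁻¹) := by positivity
  have h0 := criticality_nonneg (R := R) (g := g) y
  -- If ψ = 0 the step is zero; otherwise the predicted decrease is positive and the ratio is a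
  -- genuine quotient.
  rcases h0.eq_or_lt with h0 | h0
  · obtain rfl := step_eq_zero hns h0.symm
    rw [hR.map_zero, ← h0]
    simp
  · have hpred : 0 < model R g y 0 - model R g y s := (mul_pos hpos h0).trans_le hdec
    rw [ratio, if_neg hpred.ne', le_div_iff₀ hpred] at hratio
    have := mul_le_mul_of_nonneg_left hdec hη.le
    linarith

/-- Iterations with a small radius parameter are successful. -/
theorem le_ratio_of_gamma_le (hR : IsRetraction R) (hg : ContMDiff 𝓘(ℝ, E) 𝓘(ℝ, ℝ) 3 g)
    (hγ : 0 < γ) (hC : 0 < C) (hgrad : ‖(rgrad g y : TangentSpace 𝓘(ℝ, E) y)‖ ≤ C)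
    (hbound : ∀ u : TangentSpace 𝓘(ℝ, E) y,
      |⟪u, hessian (pullback R g y) 0 u⟫_ℝ| ≤ C * ‖u‖ ^ 2)
    (hns : ‖s‖ ≤ radius R g y γ)
    (hs : ∃ sc, IsCauchyStep R g y (radius R g y γ) sc ∧ model R g y s ≤ model R g y sc)
    {B η : ℝ} (hB : 0 ≤ B) (herr : |g (R ⟨y, s⟩) - model R g y s| ≤ B * ‖s‖ ^ 3)
    (hη : η < 1) (hγC : γ ≤ C⁻¹) (hγB : B * γ ≤ (1 - η) / 2) : η ≤ ratio R g y s := by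
  unfold ratio
  split_ifs with hz
  · exact hη.le
  have hψ := criticality_nonneg (R := R) (g := g) y
  -- 1 - ρ is the model error over the predicted decrease, so it suffices that the error is at most
  -- (1 - η)dψ.
  have main : ∀ d : ℝ, 0 ≤ d → d * criticality R g y ≤ model R g y 0 - model R g y s →
      B * ‖s‖ ^ 3 ≤ (1 - η) * (d * criticality R g y) →
      η ≤ (g y - g (R ⟨y, s⟩)) / (model R g y 0 - model R g y s) := by
    intro d hd h1 h2
    have hpred : 0 < model R g y 0 - model R g y s :=
      lt_of_le_of_ne ((mul_nonneg hd hψ).trans h1) (Ne.symm hz)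
    rw [le_div_iff₀ hpred]
    have h3 := (le_abs_self _).trans (herr.trans h2)
    have h4 := mul_le_mul_of_nonneg_left h1 (sub_nonneg.2 hη.le)
    have h5 : model R g y 0 = g y := model_zero y
    linarith
  by_cases hE : IsEigenStep R g y
  · refine main _ (by positivity) (model_decrease_of_isEigenStep hR hg hγ.le hE hs) ?_
    have h1 : B * ‖s‖ ^ 3 ≤ B * (γ * |min (lam R g y) 0|) ^ 3 := by
      rw [radius, if_pos hE] at hns
      gcongr
    have h2 : B * γ * (γ ^ 2 * criticality R g y)
        ≤ (1 - η) / 2 * (γ ^ 2 * criticality R g y) := by gcongr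
    rw [criticality, if_pos hE] at h2 ⊢
    linarith
  · have hdec := model_decrease_of_not_isEigenStep hR hg hγ.le hC hbound hE hs
    rw [min_eq_left hγC] at hdec
    refine main _ (by positivity) hdec ?_
    have h1 : B * ‖s‖ ^ 3 ≤ B * (γ * ‖(rgrad g y : TangentSpace 𝓘(ℝ, E) y)‖) ^ 3 := by
      rw [radius, if_neg hE] at hns
      gcongr
    -- The cubic error has one more factor ‖∇g‖ than ψ = ‖∇g‖²; this bound absorbs it.
    have hγd : γ * ‖(rgrad g y : TangentSpace 𝓘(ℝ, E) y)‖ ≤ 1 := by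
      calc _ ≤ C⁻¹ * C := by gcongr
        _ = 1 := inv_mul_cancel₀ hC.ne'
    have h2 : B * γ * (γ * criticality R g y * (γ * ‖(rgrad g y : TangentSpace 𝓘(ℝ, E) y)‖))
        ≤ (1 - η) / 2 * (γ * criticality R g y * 1) := by
      gcongr
    rw [criticality, if_neg hE] at h2 ⊢
    linarith

end Step

end HookedTR

namespace HookedTR

/-! ### Accumulation points. -/

section Limit

variable {E : Type*} [NormedAddCommGroup E] [NormedSpace ℝ E] [FiniteDimensional ℝ E]
  {M : Type*} [TopologicalSpace M] [ChartedSpace E M] [IsManifold 𝓘(ℝ, E) ∞ M]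
  [RiemannianBundle (fun y : M => TangentSpace 𝓘(ℝ, E) y)]
  [IsContinuousRiemannianBundle E (fun y : M => TangentSpace 𝓘(ℝ, E) y)]
  {R : TangentBundle 𝓘(ℝ, E) M → M} {g : M → ℝ}

/-- Continuity at z alone is required because the extended fields are only known to be continuous
there. -/
theorem nonneg_of_mapClusterPt {X : Type*} [TopologicalSpace X] {z : X} {y : ℕ → X}
    (hz : MapClusterPt z atTop y) {f : X → ℝ} (hf : ContinuousAt f z)
    (h : ∀ᶠ k in atTop, 0 ≤ f (y k)) : 0 ≤ f z := by
  by_contra! hneg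
  have h1 : ∃ᶠ k in atTop, f (y k) < 0 := hz.frequently (hf.eventually (gt_mem_nhds hneg))
  obtain ⟨k, hk, hk'⟩ := (h1.and_eventually h).exists
  exact absurd hk' (not_le.2 hk)

/-- At a cluster point of a sequence along which the criticality measure tends to zero, the
differential of the cost vanishes and the second derivative along retraction curves is
nonnegative. -/
theorem criticality_at_cluster_point (hR : IsRetraction R) (hg : ContMDiff 𝓘(ℝ, E) 𝓘(ℝ, ℝ) 3 g)
    {y : ℕ → M} (hψ : Tendsto (fun k => criticality R g (y k)) atTop (𝓝 0)) {z : M}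
    (hz : MapClusterPt z atTop y) (u : TangentSpace 𝓘(ℝ, E) z) :
    deriv (lineCost R g ⟨z, u⟩) 0 ≤ 0 ∧ 0 ≤ deriv (deriv (lineCost R g ⟨z, u⟩)) 0 := by
  obtain ⟨U, rfl, hU⟩ := exists_section_continuousAt z u
  have hU0 : ContinuousAt (fun y => ((⟨y, U y⟩ : TangentBundle 𝓘(ℝ, E) M), (0 : ℝ))) z :=
    hU.prodMk continuousAt_const
  have ha : ContinuousAt (fun y => deriv (lineCost R g ⟨y, U y⟩) 0) z :=
    (contMDiff_deriv_lineCost hR hg).continuous.continuousAt.comp hU0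
  have hb : ContinuousAt (fun y => deriv (deriv (lineCost R g ⟨y, U y⟩)) 0) z :=
    (contMDiff_deriv_deriv_lineCost hR hg).continuous.continuousAt.comp hU0
  have hn2 : ContinuousAt (fun y => ‖U y‖ ^ 2) z := by
    have := ContinuousAt.inner_bundle (F := E) hU hU
    simpa only [real_inner_self_eq_norm_sq] using this
  have hn : ContinuousAt (fun y => ‖U y‖) z := by
    have := hn2.sqrt
    simpa only [Real.sqrt_sq (norm_nonneg _)] using this
  have hsmall : ∀ ε > 0, ∀ᶠ k in atTop,
      ‖(rgrad g (y k) : TangentSpace 𝓘(ℝ, E) (y k))‖ ≤ ε ∧ -ε ≤ lam R g (y k) := by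
    intro ε hε
    filter_upwards [hψ.eventually (gt_mem_nhds (show 0 < ε ^ 2 by positivity)),
      hψ.eventually (gt_mem_nhds (show 0 < ε ^ 3 by positivity))] with k h2 h3
    constructor
    · exact (lt_of_pow_lt_pow_left₀ 2 hε.le
        ((norm_rgrad_sq_le_criticality (R := R) (y k)).trans_lt h2)).le
    · have h4 := lt_of_pow_lt_pow_left₀ 3 hε.le
        ((abs_min_lam_pow_le_criticality (R := R) (g := g) (y k)).trans_lt h3)
      exact (abs_lt.1 h4).1.le.trans (min_le_left _ _)
  constructor
  · have key : ∀ ε > 0, deriv (lineCost R g ⟨z, U z⟩) 0 ≤ ε * ‖U z‖ := by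
      intro ε hε
      refine sub_nonneg.1 (nonneg_of_mapClusterPt hz ((hn.const_mul ε).sub ha) ?_)
      filter_upwards [hsmall ε hε] with k hk
      change 0 ≤ ε * ‖U (y k)‖ - deriv (lineCost R g ⟨y k, U (y k)⟩) 0
      rw [sub_nonneg, ← inner_rgrad_eq_deriv hR hg, mul_comm]
      exact (real_inner_le_norm _ _).trans (by gcongr; exact hk.1)
    have hlim : Tendsto (fun ε : ℝ => ε * ‖U z‖) (𝓝[>] 0) (𝓝 (0 * ‖U z‖)) :=
      ((continuous_mul_const _).tendsto 0).mono_left nhdsWithin_le_nhds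
    rw [zero_mul] at hlim
    exact ge_of_tendsto hlim (eventually_mem_nhdsWithin.mono fun ε hε => key ε hε)
  · have key : ∀ ε > 0, 0 ≤ deriv (deriv (lineCost R g ⟨z, U z⟩)) 0 + ε * ‖U z‖ ^ 2 := by
      intro ε hε
      refine nonneg_of_mapClusterPt hz (hb.add (hn2.const_mul ε)) ?_
      filter_upwards [hsmall ε hε] with k hk
      have h1 := lam_mul_norm_sq_le hR hg (y k) (U (y k))
      rw [inner_hessian_pullback hR hg] at h1
      have h2 : -ε * ‖U (y k)‖ ^ 2 ≤ lam R g (y k) * ‖U (y k)‖ ^ 2 := by gcongr; exact hk.2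
      change 0 ≤ deriv (deriv (lineCost R g ⟨y k, U (y k)⟩)) 0 + ε * ‖U (y k)‖ ^ 2
      linarith
    have hlim : Tendsto (fun ε : ℝ => deriv (deriv (lineCost R g ⟨z, U z⟩)) 0 + ε * ‖U z‖ ^ 2)
        (𝓝[>] 0) (𝓝 (deriv (deriv (lineCost R g ⟨z, U z⟩)) 0 + 0 * ‖U z‖ ^ 2)) :=
      (Continuous.tendsto (by fun_prop) 0).mono_left nhdsWithin_le_nhds
    rw [zero_mul, add_zero] at hlim
    exact ge_of_tendsto hlim (eventually_mem_nhdsWithin.mono fun ε hε => key ε hε)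

end Limit

/-! ### From retraction curves to all smooth curves. -/

section TwoCritical

variable {E : Type*} [NormedAddCommGroup E] [NormedSpace ℝ E]
  {M : Type*} [TopologicalSpace M] [ChartedSpace E M] [IsManifold 𝓘(ℝ, E) ∞ M]
  {R : TangentBundle 𝓘(ℝ, E) M → M} {g : M → ℝ}

/-- Second-order criticality can be tested along retraction curves. -/
theorem isTwoCritical_of_lineCost (hR : IsRetraction R) (hg : ContMDiff 𝓘(ℝ, E) 𝓘(ℝ, ℝ) 3 g)
    {z : M} (h : ∀ u : TangentSpace 𝓘(ℝ, E) z, deriv (lineCost R g ⟨z, u⟩) 0 ≤ 0 ∧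
      0 ≤ deriv (deriv (lineCost R g ⟨z, u⟩)) 0) : IsTwoCritical E g z := by
  have hdg : mfderiv 𝓘(ℝ, E) 𝓘(ℝ, ℝ) g z = 0 := by
    ext u
    have h1 := (h u).1
    -- The one-sided bound at both u and -u forces the differential to vanish.
    have h2 := (h (-u)).1
    rw [deriv_lineCost_zero hR hg] at h1 h2
    rw [map_neg] at h2
    exact le_antisymm (α := ℝ) h1 (neg_nonpos (α := ℝ).1 h2)
  rintro c hc rfl
  constructor
  · rw [deriv_comp_curve (hg.mdifferentiable three_ne_zero) (hc.mdifferentiable (by simp)), hdg]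
    rfl
  · have h0 : R ⟨c 0, (0 : ℝ) • (mfderiv 𝓘(ℝ, ℝ) 𝓘(ℝ, E) c 0 (1 : ℝ))⟩ = c 0 := by
      rw [zero_smul, hR.map_zero]
    rw [deriv_deriv_comp_curve_eq (hg.of_le (by norm_num)) hdg (hc.of_le ENat.LEInfty.out)
      ((contMDiff_retraction_curve hR (c 0) (mfderiv 𝓘(ℝ, ℝ) 𝓘(ℝ, E) c 0 (1 : ℝ))).of_le
        ENat.LEInfty.out) rfl h0 (mfderiv_retraction_curve hR _ _).symm]
    exact (h _).2

end TwoCritical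

section Metric

theorem isContinuousRiemannianBundle_of_contMDiff {E : Type*} [NormedAddCommGroup E]
    [NormedSpace ℝ E] {M : Type*} [TopologicalSpace M] [ChartedSpace E M]
    [IsManifold 𝓘(ℝ, E) ∞ M] [RiemannianBundle (fun y : M => TangentSpace 𝓘(ℝ, E) y)]
    [h : IsContMDiffRiemannianBundle 𝓘(ℝ, E) ∞ E (fun y : M => TangentSpace 𝓘(ℝ, E) y)] :
    IsContinuousRiemannianBundle E (fun y : M => TangentSpace 𝓘(ℝ, E) y) := by
  obtain ⟨m, hm, hinner⟩ := h.exists_contMDiff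
  exact ⟨m, hm.continuous, hinner⟩

end Metric

/-! ### Global behaviour of a run. -/

section Run

variable {E : Type*} [NormedAddCommGroup E] [NormedSpace ℝ E] [FiniteDimensional ℝ E]
  {M : Type*} [TopologicalSpace M] [ChartedSpace E M]
  [RiemannianBundle (fun y : M => TangentSpace 𝓘(ℝ, E) y)]
  {R : TangentBundle 𝓘(ℝ, E) M → M} {g : M → ℝ} {Φ : M → M} {γc η γlo γhi : ℝ} {yin : M}
  {y : ℕ → M} {s : ∀ k, TangentSpace 𝓘(ℝ, E) (y k)} {γ : ℕ → ℝ}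

theorem IsRun.gamma_mem (hrun : IsRun R g Φ γc η γlo γhi yin y s γ) (hγc : γc ∈ Ioo (0 : ℝ) 1)
    (hγlo : 0 < γlo) (k : ℕ) : 0 < γ k ∧ γ k ≤ γhi := by
  induction k with
  | zero => exact ⟨hγlo.trans_le hrun.init_gamma.1, hrun.init_gamma.2⟩
  | succ k ih =>
    by_cases h : η ≤ ratio R g (y k) (s k)
    · have := (hrun.success k h).2
      exact ⟨hγlo.trans_le this.1, this.2⟩
    · rw [(hrun.failure k (not_le.1 h)).2]
      exact ⟨mul_pos hγc.1 ih.1, (mul_le_of_le_one_left ih.1.le hγc.2.le).trans ih.2⟩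

variable [IsManifold 𝓘(ℝ, E) ∞ M]

/-- Membership in L precedes any compactness assumption, so the Hessian bound is taken at the single
point y_k, with ‖A‖ + 1 to make it positive. -/
theorem IsRun.cost_retraction_le (hrun : IsRun R g Φ γc η γlo γhi yin y s γ)
    (hR : IsRetraction R) (hg : ContMDiff 𝓘(ℝ, E) 𝓘(ℝ, ℝ) 3 g) (hγc : γc ∈ Ioo (0 : ℝ) 1)
    (hη : 0 < η) (hγlo : 0 < γlo) {k : ℕ} (hk : η ≤ ratio R g (y k) (s k)) :
    g (R ⟨y k, s k⟩) ≤ g (y k) := by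
  have hγ := (hrun.gamma_mem hγc hγlo k).1
  set A := hessian (pullback R g (y k)) 0
  have hC : 0 < ‖A‖ + 1 := by positivity
  refine (cost_decrease hR hg hγ hC (fun u => ?_) (hrun.norm_step k) (hrun.model_step k)
    hη hk).trans (sub_le_self _ (mul_nonneg (by positivity) (criticality_nonneg _)))
  calc |⟪u, A u⟫_ℝ| ≤ ‖u‖ * ‖A u‖ := abs_real_inner_le_norm _ _
    _ ≤ ‖u‖ * (‖A‖ * ‖u‖) := by gcongr; exact A.le_opNorm u
    _ ≤ (‖A‖ + 1) * ‖u‖ ^ 2 := by nlinarith [sq_nonneg ‖u‖]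

theorem IsRun.cost_succ_le (hrun : IsRun R g Φ γc η γlo γhi yin y s γ)
    (hR : IsRetraction R) (hg : ContMDiff 𝓘(ℝ, E) 𝓘(ℝ, ℝ) 3 g) (hΦ : ∀ z, g (Φ z) = g z)
    (hγc : γc ∈ Ioo (0 : ℝ) 1) (hη : 0 < η) (hγlo : 0 < γlo) (k : ℕ) :
    g (y (k + 1)) ≤ g (y k) := by
  by_cases hk : η ≤ ratio R g (y k) (s k)
  · rw [(hrun.success k hk).1, hΦ]
    exact hrun.cost_retraction_le hR hg hγc hη hγlo hk
  · rw [(hrun.failure k (not_le.1 hk)).1]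

theorem IsRun.mem_image_sublevel (hrun : IsRun R g Φ γc η γlo γhi yin y s γ)
    (hR : IsRetraction R) (hg : ContMDiff 𝓘(ℝ, E) 𝓘(ℝ, ℝ) 3 g) (hΦ : ∀ z, g (Φ z) = g z)
    (hγc : γc ∈ Ioo (0 : ℝ) 1) (hη : 0 < η) (hγlo : 0 < γlo) (k : ℕ) :
    y k ∈ Φ '' {z : M | g z ≤ g (y 0)} := by
  have hanti : Antitone fun k => g (y k) :=
    antitone_nat_of_succ_le (hrun.cost_succ_le hR hg hΦ hγc hη hγlo)
  induction k with
  | zero => exact ⟨yin, by rw [mem_ofPred_eq, hrun.init, hΦ], hrun.init.symm⟩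
  | succ k ih =>
    by_cases hk : η ≤ ratio R g (y k) (s k)
    · rw [(hrun.success k hk).1]
      exact ⟨_, (hrun.cost_retraction_le hR hg hγc hη hγlo hk).trans (hanti (Nat.zero_le k)), rfl⟩
    · rwa [(hrun.failure k (not_le.1 hk)).1]

variable [IsContinuousRiemannianBundle E (fun y : M => TangentSpace 𝓘(ℝ, E) y)]

/-- The criticality measure tends to zero along a run that stays in a compact set. -/
theorem IsRun.tendsto_criticality (hrun : IsRun R g Φ γc η γlo γhi yin y s γ)
    (hR : IsRetraction R) (hg : ContMDiff 𝓘(ℝ, E) 𝓘(ℝ, ℝ) 3 g) (hΦ : ∀ z, g (Φ z) = g z)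
    (hγc : γc ∈ Ioo (0 : ℝ) 1) (hη : η ∈ Ioo (0 : ℝ) 1) (hγlo : 0 < γlo) {K : Set M}
    (hK : IsCompact K) (hyK : ∀ k, y k ∈ K) :
    Tendsto (fun k => criticality R g (y k)) atTop (𝓝 0) := by
  obtain ⟨C, hC, hCK⟩ := exists_derivative_bound hR hg hK
  -- γhi * C bounds every trust-region radius along the run.
  obtain ⟨B, hB, hBK⟩ := exists_model_error_bound hR hg hK (γhi * C)
  obtain ⟨b, hb⟩ := hK.exists_bound_of_continuousOn hg.continuous.continuousOn
  have hγ := hrun.gamma_mem hγc hγlo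
  have hη1 : 0 < 1 - η := sub_pos.2 hη.2
  -- Below this threshold both smallness conditions for acceptance hold; B + 1 avoids division by
  -- zero.
  set γs := min C⁻¹ ((1 - η) / 2 / (B + 1))
  have hγs : 0 < γs := by positivity
  have hbig : ∀ k, ¬ η ≤ ratio R g (y k) (s k) → γs < γ k := by
    intro k hk
    by_contra! hle
    refine hk (le_ratio_of_gamma_le hR hg (hγ k).1 hC (hCK _ (hyK k)).1 (hCK _ (hyK k)).2
      (hrun.norm_step k) (hrun.model_step k) hB (hBK _ (hyK k) _ ?_) hη.2
      (hle.trans (min_le_left _ _)) ?_)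
    · refine (hrun.norm_step k).trans ((radius_le (hγ k).1.le (hCK _ (hyK k)).1
        (hCK _ (hyK k)).2 (hrun.model_step k)).trans ?_)
      gcongr
      exact (hγ k).2
    · have h1 := hle.trans (min_le_right _ _)
      rw [le_div_iff₀ (by positivity)] at h1
      linarith [(hγ k).1]
  have hlow := min_le_gamma hγc.1 hrun.init_gamma.1 (fun k hk => (hrun.success k hk).2.1)
    (fun k hk => (hrun.failure k (not_le.1 hk)).2) hbig
  set γm := min γlo (γc * γs)
  -- A failure starts from γ > γs and multiplies by γc, hence the floor γc * γs.
  have hγm : 0 < γm := lt_min hγlo (mul_pos hγc.1 hγs)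
  have hη0 := hη.1
  refine tendsto_criticality_zero (S := fun k => η ≤ ratio R g (y k) (s k))
    (G := fun k => g (y k)) (b := -b) (c := η * (1 / 2 * min (γm ^ 2) (min γm C⁻¹)))
    (by positivity) (fun k => neg_le_of_abs_le (hb _ (hyK k)))
    (fun k => criticality_nonneg _) (hrun.cost_succ_le hR hg hΦ hγc hη.1 hγlo) (fun k hk => ?_)
    (fun k hk => by rw [(hrun.failure k (not_le.1 hk)).1])
    (exists_success hγc.1 hγc.2 hγm hlow fun k hk => (hrun.failure k (not_le.1 hk)).2)
  rw [(hrun.success k hk).1, hΦ]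
  refine (cost_decrease hR hg (hγ k).1 hC (hCK _ (hyK k)).2 (hrun.norm_step k)
    (hrun.model_step k) hη.1 hk).trans ?_
  have h0 := criticality_nonneg (R := R) (g := g) (y k)
  have := hlow k
  gcongr

end Run

end HookedTR

theorem mainTheorem7
    -- the Riemannian manifold `M`
    {E : Type*} [NormedAddCommGroup E] [NormedSpace ℝ E] [FiniteDimensional ℝ E]
    {M : Type*} [TopologicalSpace M] [T2Space M] [SecondCountableTopology M]
    [ChartedSpace E M] [IsManifold 𝓘(ℝ, E) ∞ M]
    [RiemannianBundle (fun y : M => TangentSpace 𝓘(ℝ, E) y)]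
    [IsContMDiffRiemannianBundle 𝓘(ℝ, E) ∞ E (fun y : M => TangentSpace 𝓘(ℝ, E) y)]
    -- the smooth lift `φ : M → F` of the set `X ⊆ F`
    {F : Type*} [NormedAddCommGroup F] [InnerProductSpace ℝ F] [FiniteDimensional ℝ F]
    (X : Set F) (φ : M → F) (hφ : ContMDiff 𝓘(ℝ, E) 𝓘(ℝ, F) ∞ φ) (hX : range φ = X)
    -- the cost function `f`, of which only the values on `X` matter, and its lift `g = f ∘ φ`
    (f : F → ℝ) (g : M → ℝ) (hgf : g = f ∘ φ)
    (hg : ContMDiff 𝓘(ℝ, E) 𝓘(ℝ, ℝ) 3 g)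
    -- the retraction and the hook
    (R : TangentBundle 𝓘(ℝ, E) M → M) (hR : HookedTR.IsRetraction R)
    (Φ : M → M) (hΦ : φ ∘ Φ = φ)
    -- the parameters of the algorithm and a sequence that it generates
    (γc η γlo γhi : ℝ) (hγc : γc ∈ Ioo (0 : ℝ) 1) (hη : η ∈ Ioo (0 : ℝ) 1)
    (hγlo : 0 < γlo) (hγ : γlo ≤ γhi)
    (yin : M) (y : ℕ → M) (s : ∀ k, TangentSpace 𝓘(ℝ, E) (y k)) (γ : ℕ → ℝ)
    (hrun : HookedTR.IsRun R g Φ γc η γlo γhi yin y s γ)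
    -- the set `L`, and `x₀ = φ (y 0)`
    (L : Set M) (hL : L = Φ '' {z : M | g z ≤ g (y 0)}) (x₀ : F) (hx₀ : x₀ = φ (y 0)) :
    L = Φ '' (φ ⁻¹' {x : F | x ∈ X ∧ f x ≤ f x₀}) ∧
    (∀ k, y k ∈ L) ∧
    ((∃ K : Set M, IsCompact K ∧ L ⊆ K) →
      (∃ z : M, MapClusterPt z atTop y) ∧
      ∀ z : M, MapClusterPt z atTop y → HookedTR.IsTwoCritical E g z) := by
  have hΦg : ∀ z, g (Φ z) = g z := fun z => by
    rw [hgf, Function.comp_apply, Function.comp_apply, ← Function.comp_apply (f := φ), hΦ]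
  have hmem : ∀ k, y k ∈ L := fun k => by
    rw [hL]
    exact hrun.mem_image_sublevel hR hg hΦg hγc hη.1 hγlo k
  refine ⟨?_, hmem, ?_⟩
  · rw [hL, hx₀]
    congr 1
    ext z
    simp [hgf, ← hX]
  · rintro ⟨K, hK, hLK⟩
    have hyK : ∀ k, y k ∈ K := fun k => hLK (hmem k)
    have : IsContinuousRiemannianBundle E (fun y : M => TangentSpace 𝓘(ℝ, E) y) :=
      HookedTR.isContinuousRiemannianBundle_of_contMDiff
    have hψ := hrun.tendsto_criticality hR hg hΦg hγc hη hγlo hK hyK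
    refine ⟨?_, fun z hz => HookedTR.isTwoCritical_of_lineCost hR hg
      (HookedTR.criticality_at_cluster_point hR hg hψ hz)⟩
    obtain ⟨z, -, hz⟩ := hK.exists_mapClusterPt (f := atTop) (u := y)
      (tendsto_principal.2 (Eventually.of_forall hyK))
    exact ⟨z, hz⟩
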